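/- **Setting.** A *braided Ann-category* $\mathcal A$ is a groupoid with a symmetric monoidal structure $(\oplus,a^+,c^+,(0,g,d))$ in which every object is invertible, a braided monoidal structure $(\otimes,a,c,(1,l,r))$, and natural isomorphisms $\mathfrak L_{A,X,Y}:A(X\oplus Y)\to AX\oplus AY$, $\mathfrak R_{X,Y,A}:(X\oplus Y)A\to XA\oplus YA$ such that $A\otimes-$ and $-\otimes A$ are compatible with $a^+,c^+$, the usual coherence diagrams between $\mathfrak L,\mathfrak R$ and $a,l,r$, and the diagram comparing $\mathfrak L_{A\oplus B,X,Y}$ with $\mathfrak R_{A,B,X\oplus Y}$ commute, $(c_{A,X}\oplus c_{A,Y})\mathfrak L_{A,X,Y}=\mathfrak R_{X,Y,A}\,c_{A,X\oplus Y}$, and $c_{0,0}=\mathrm{id}$. Here $a^+_{X,Y,Z}:X\oplus(Y\oplus Z)\to(X\oplus Y)\oplus Z$ and $a_{X,Y,Z}:X(YZ)\to(XY)Z$. A *braided Ann-functor* is a functor that is symmetric monoidal for $\oplus$, braided monoidal for $\otimes$, and compatible with $\mathfrak L,\mathfrak R$; it is a *braided Ann-equivalence* if it has an inverse braided Ann-functor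 up to natural isomorphisms that are monoidal for both $\oplus$ and $\otimes$. Let $R=\pi_0\mathcal A$ be the commutative ring of isomorphism classes of objects and $M=\pi_1\mathcal A=\mathrm{Aut}(0)$, an $R$-module by $[X]\cdot u=\hat L^X(\mathrm{id}_X\otimes u)(\hat L^X)^{-1}$, where $\hat L^X:X\otimes 0\to 0$, $\hat R^X:0\otimes X\to 0$ are the isomorphisms by which $X\otimes-$, $-\otimes X$ preserve $0$. Let $\gamma_X:M\to\mathrm{Aut}(X)$ be the bijection $\gamma_X(u)=g_X(u\oplus\mathrm{id}_X)g_X^{-1}$. A *stick* $(X_s,\varphi,\psi)$ in $\mathcal A$ consists of representatives $X_s\in s$ ($s\in R$) with $X_0=0$, $X_1=1$, and isomorphisms $\varphi_{s,t}:X_s\oplus X_t\to X_{s+t}$, $\psi_{s,t}:X_sX_t\to X_{st}$ with $\varphi_{0,t}=g_{X_t}$, $\varphi_{s,0}=d_{X_s}$, $\psi_{1,t}=l_{X_t}$, $\psi_{s,1}=r_{X_s}$, $\psi_{0,t}=\hat R^{X_t}$, $\psi_{s,0}=\hat L^{X_s}$. It induces maps $\xi,\alpha,\lambda,\rho:R^3\to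 M$, $\eta,\beta:R^2\to M$ by transporting $a^+,a,\mathfrak L,\mathfrak R,c^+,c$ along $\varphi,\psi$ and identifying $\mathrm{Aut}(X_s)$ with $M$ by $\gamma_{X_s}$; for instance $\psi_{s,r}c_{X_r,X_s}\psi_{r,s}^{-1}=\gamma_{X_{rs}}(\beta(r,s))$. Put $h=(\xi,\eta,\alpha,\lambda,\rho)$; $(h,\beta)$ is the *structure* of the stick. The *reduced braided Ann-category* $s\mathcal A$ of the stick has the elements of $R$ as objects, the pairs $(s,u):s\to s$, $u\in M$, as morphisms, $(s,u)(s,v)=(s,u+v)$, $(s,u)\oplus(t,v)=(s+t,u+v)$, $(s,u)\otimes(t,v)=(st,sv+tu)$, strict units, and $\xi,\eta,\alpha,\beta,\lambda,\rho$ as its constraints $a^+,c^+,a,c,\mathfrak L,\mathfrak R$. $Z^3_{ab}(R,M)$ is the group of $(h,\beta)=((\xi,\eta,\alpha,\lambda,\rho),\beta)$ such that, for all $x,y,z,t\in R$, $$\begin{aligned} &\xi(y,z,t)-\xi(x+y,z,t)+\xi(x,y+z,t)-\xi(x,y,z+t)+\xi(x,y,z)=0,\\ &\xi(x,y,z)-\xi(x,z,y)+\xi(z,x,y)+\eta(x+y,z)-\eta(x,z)-\eta(y,z)=0,\qquad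 \eta(x,y)+\eta(y,x)=0,\\ &x\eta(y,z)-\eta(xy,xz)=\lambda(x,y,z)-\lambda(x,z,y),\qquad z\eta(x,y)-\eta(xz,yz)=\rho(x,y,z)-\rho(y,x,z),\\ &x\xi(y,z,t)-\xi(xy,xz,xt)=\lambda(x,z,t)-\lambda(x,y+z,t)+\lambda(x,y,z+t)-\lambda(x,y,z),\\ &t\xi(x,y,z)-\xi(xt,yt,zt)=\rho(y,z,t)-\rho(x+y,z,t)+\rho(x,y+z,t)-\rho(x,y,t),\\ &\rho(x,y,z+t)-\rho(x,y,z)-\rho(x,y,t)+\lambda(x,z,t)+\lambda(y,z,t)-\lambda(x+y,z,t)\\ &\quad=-\xi(xz+xt,yz,yt)+\xi(xz,xt,yz)-\eta(xt,yz)+\xi(xz+yz,xt,yt)-\xi(xz,yz,xt),\\ &\alpha(x,y,z+t)-\alpha(x,y,z)-\alpha(x,y,t)=x\lambda(y,z,t)+\lambda(x,yz,yt)-\lambda(xy,z,t),\\ &\alpha(x,y+z,t)-\alpha(x,y,t)-\alpha(x,z,t)=x\rho(y,z,t)-\rho(xy,xz,t)+\lambda(x,yt,zt)-t\lambda(x,y,z),\\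 &\alpha(x+y,z,t)-\alpha(x,z,t)-\alpha(y,z,t)=-t\rho(x,y,z)-\rho(xz,yz,t)+\rho(x,y,zt),\\ &x\alpha(y,z,t)-\alpha(xy,z,t)+\alpha(x,yz,t)-\alpha(x,y,zt)+t\alpha(x,y,z)=0,\\ &\alpha(x,y,z)-\alpha(x,z,y)+\alpha(z,x,y)-x\beta(y,z)+\beta(xy,z)-y\beta(x,z)=0,\\ &\alpha(x,y,z)-\alpha(y,x,z)+\alpha(y,z,x)+y\beta(x,z)-\beta(x,yz)+z\beta(x,y)=0,\\ &\beta(x,y)-\beta(x,y+z)+\beta(x,z)=\rho(y,z,x)-\lambda(x,y,z), \end{aligned}$$ and such that $\xi,\alpha,\lambda,\rho$ vanish when an argument is $0$, $\alpha$ vanishes when an argument is $1$, and $\lambda(1,y,z)=0=\rho(x,y,1)$. $B^3_{ab}(R,M)\subset Z^3_{ab}(R,M)$ is the subgroup of the $\partial(\mu,\nu)$, for $\mu,\nu:R^2\to M$ with $\mu(0,y)=\mu(x,0)=0$, $\nu(0,y)=\nu(x,0)=\nu(1,y)=\nu(x,1)=0$, where $\partial(\mu,\nu)$ is given by $$\begin{aligned}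 \xi(x,y,z)&=\mu(y,z)-\mu(x+y,z)+\mu(x,y+z)-\mu(x,y),\qquad \eta(x,y)=\mu(x,y)-\mu(y,x),\\ \alpha(x,y,z)&=x\nu(y,z)-\nu(xy,z)+\nu(x,yz)-z\nu(x,y),\qquad \beta(x,y)=\nu(x,y)-\nu(y,x),\\ \lambda(x,y,z)&=\nu(x,y+z)-\nu(x,y)-\nu(x,z)+x\mu(y,z)-\mu(xy,xz),\\ \rho(x,y,z)&=\nu(x+y,z)-\nu(x,z)-\nu(y,z)+z\mu(x,y)-\mu(xz,yz), \end{aligned}$$ and $H^3_{ab}=Z^3_{ab}/B^3_{ab}$. **Proposition.** Let $\mathcal A$ be a braided Ann-category with $R=\pi_0\mathcal A$, $M=\pi_1\mathcal A$, and let $(X_s,\varphi,\psi)$ and $(X'_s,\varphi',\psi')$ be two sticks in $\mathcal A$ with structures $(h,\beta)$ and $(h',\beta')$. Then $(h,\beta),(h',\beta')\in Z^3_{ab}(R,M)$, and for the corresponding reduced braided Ann-categories $s\mathcal A$ and $s\mathcal A'$: (i) there is a braided Ann-equivalence $(F,\breve F,\widetilde F):s\mathcal A'\to s\mathcal A$ whose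 underlying functor $F$ is the identity; (ii) $(h,\beta)$ and $(h',\beta')$ have the same class in $H^3_{ab}(R,M)$. -/

import Mathlib

universe v u v₁ u₁ v₂ u₂

open CategoryTheory MonoidalCategory

set_option linter.unusedSimpArgs false
set_option linter.unusedSectionVars false
set_option linter.unusedVariables false

namespace BrAnn

/-! ## Ann-categories -/

/-- A symmetric categorical group structure on `C`, written additively: a symmetric monoidal
structure `plus` on a groupoid in which every object is invertible up to isomorphism.  Since an
Ann-category carries a second monoidal structure, `plus` is a field and not an instance. -/
class SymCatGroup (C : Type u) [Category.{v} C] where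
  /-- the sum of objects and morphisms, with its associativity and unit constraints -/
  plus : MonoidalCategory C
  /-- the commutativity constraint of the sum -/
  plusSymm : @SymmetricCategory C _ plus
  isGroupoid : IsGroupoid C
  exists_neg : ∀ X : C, ∃ Y : C, Nonempty (plus.tensorObj X Y ≅ plus.tensorUnit)

attribute [instance] SymCatGroup.isGroupoid

section Plus

variable {C : Type u} [Category.{v} C] [SymCatGroup C]

/-- The sum of two objects. -/
abbrev add (X Y : C) : C := (SymCatGroup.plus (C := C)).tensorObj X Y

/-- The sum of two morphisms. -/
abbrev addMap {X Y X' Y' : C} (f : X ⟶ Y) (g : X' ⟶ Y') : add X X' ⟶ add Y Y' :=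
  (SymCatGroup.plus (C := C)).tensorHom f g

infixr:65 " ∔ " => add

infixr:65 " ∔ₘ " => addMap

/-- The zero object. -/
abbrev zero (C : Type u) [Category.{v} C] [SymCatGroup C] : C :=
  (SymCatGroup.plus (C := C)).tensorUnit

/-- The associativity constraint of the sum, in the direction `a⁺ : X + (Y + Z) ⟶ (X + Y) + Z`. -/
abbrev addAssoc (X Y Z : C) : X ∔ (Y ∔ Z) ≅ (X ∔ Y) ∔ Z :=
  ((SymCatGroup.plus (C := C)).associator X Y Z).symm

/-- The left unit constraint `g : 0 + X ⟶ X`. -/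
abbrev zeroAdd (X : C) : zero C ∔ X ≅ X := (SymCatGroup.plus (C := C)).leftUnitor X

/-- The right unit constraint `d : X + 0 ⟶ X`. -/
abbrev addZero (X : C) : X ∔ zero C ≅ X := (SymCatGroup.plus (C := C)).rightUnitor X

/-- The symmetry `c⁺ : X + Y ⟶ Y + X`. -/
abbrev addComm (X Y : C) : X ∔ Y ≅ Y ∔ X :=
  (SymCatGroup.plusSymm (C := C)).braiding X Y

/-- The canonical morphism `v : (U + V) + (Z + T) ⟶ (U + Z) + (V + T)`. -/
abbrev addSwap (U V Z T : C) : (U ∔ V) ∔ (Z ∔ T) ⟶ (U ∔ Z) ∔ (V ∔ T) :=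
  @tensorμ C _ SymCatGroup.plus (SymCatGroup.plusSymm (C := C)).toBraidedCategory U V Z T

end Plus

/-- An Ann-category.  The product is the ambient monoidal structure; its associativity constraint
in the direction `a : X (Y Z) ⟶ (X Y) Z` is `(α_ X Y Z).inv`. -/
class AnnCategory (C : Type u) [Category.{v} C] [MonoidalCategory C] [SymCatGroup C] where
  /-- left distributivity constraint -/
  distL : ∀ A X Y : C, A ⊗ (X ∔ Y) ≅ (A ⊗ X) ∔ (A ⊗ Y)
  /-- right distributivity constraint -/
  distR : ∀ X Y A : C, (X ∔ Y) ⊗ A ≅ (X ⊗ A) ∔ (Y ⊗ A)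
  distL_natural : ∀ {A A' X X' Y Y' : C} (f : A ⟶ A') (g : X ⟶ X') (h : Y ⟶ Y'),
    (f ⊗ₘ (g ∔ₘ h)) ≫ (distL A' X' Y').hom = (distL A X Y).hom ≫ ((f ⊗ₘ g) ∔ₘ (f ⊗ₘ h))
  distR_natural : ∀ {A A' X X' Y Y' : C} (g : X ⟶ X') (h : Y ⟶ Y') (f : A ⟶ A'),
    ((g ∔ₘ h) ⊗ₘ f) ≫ (distR X' Y' A').hom = (distR X Y A).hom ≫ ((g ⊗ₘ f) ∔ₘ (h ⊗ₘ f))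
  /-- `A ⊗ -` is compatible with the associativity of the sum -/
  distL_assoc : ∀ A X Y Z : C,
    (A ◁ (addAssoc X Y Z).hom) ≫ (distL A (X ∔ Y) Z).hom ≫ ((distL A X Y).hom ∔ₘ 𝟙 (A ⊗ Z)) =
      (distL A X (Y ∔ Z)).hom ≫ (𝟙 (A ⊗ X) ∔ₘ (distL A Y Z).hom) ≫
        (addAssoc (A ⊗ X) (A ⊗ Y) (A ⊗ Z)).hom
  /-- `A ⊗ -` is compatible with the commutativity of the sum -/
  distL_comm : ∀ A X Y : C,
    (A ◁ (addComm X Y).hom) ≫ (distL A Y X).hom =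
      (distL A X Y).hom ≫ (addComm (A ⊗ X) (A ⊗ Y)).hom
  /-- `- ⊗ A` is compatible with the associativity of the sum -/
  distR_assoc : ∀ X Y Z A : C,
    ((addAssoc X Y Z).hom ▷ A) ≫ (distR (X ∔ Y) Z A).hom ≫ ((distR X Y A).hom ∔ₘ 𝟙 (Z ⊗ A)) =
      (distR X (Y ∔ Z) A).hom ≫ (𝟙 (X ⊗ A) ∔ₘ (distR Y Z A).hom) ≫
        (addAssoc (X ⊗ A) (Y ⊗ A) (Z ⊗ A)).hom
  /-- `- ⊗ A` is compatible with the commutativity of the sum -/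
  distR_comm : ∀ X Y A : C,
    ((addComm X Y).hom ▷ A) ≫ (distR Y X A).hom =
      (distR X Y A).hom ≫ (addComm (X ⊗ A) (Y ⊗ A)).hom
  distL_mul : ∀ A B X Y : C,
    (α_ A B (X ∔ Y)).inv ≫ (distL (A ⊗ B) X Y).hom =
      (A ◁ (distL B X Y).hom) ≫ (distL A (B ⊗ X) (B ⊗ Y)).hom ≫
        ((α_ A B X).inv ∔ₘ (α_ A B Y).inv)
  distR_mul : ∀ X Y B A : C,
    (distR X Y (B ⊗ A)).hom ≫ ((α_ X B A).inv ∔ₘ (α_ Y B A).inv) =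
      (α_ (X ∔ Y) B A).inv ≫ ((distR X Y B).hom ▷ A) ≫ (distR (X ⊗ B) (Y ⊗ B) A).hom
  distL_distR : ∀ A X Y B : C,
    (α_ A (X ∔ Y) B).inv ≫ ((distL A X Y).hom ▷ B) ≫ (distR (A ⊗ X) (A ⊗ Y) B).hom =
      (A ◁ (distR X Y B).hom) ≫ (distL A (X ⊗ B) (Y ⊗ B)).hom ≫
        ((α_ A X B).inv ∔ₘ (α_ A Y B).inv)
  dist_swap : ∀ A B X Y : C,
    (distL (A ∔ B) X Y).hom ≫ ((distR A B X).hom ∔ₘ (distR A B Y).hom) ≫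
        addSwap (A ⊗ X) (B ⊗ X) (A ⊗ Y) (B ⊗ Y) =
      (distR A B (X ∔ Y)).hom ≫ ((distL A X Y).hom ∔ₘ (distL B X Y).hom)
  distL_one : ∀ X Y : C,
    (distL (𝟙_ C) X Y).hom ≫ ((λ_ X).hom ∔ₘ (λ_ Y).hom) = (λ_ (X ∔ Y)).hom
  distR_one : ∀ X Y : C,
    (distR X Y (𝟙_ C)).hom ≫ ((ρ_ X).hom ∔ₘ (ρ_ Y).hom) = (ρ_ (X ∔ Y)).hom


open AnnCategory

/-- A braided Ann-category: the braiding of the product is compatible with the distributivity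
constraints and is the identity on `0 ⊗ 0`. -/
class BraidedAnnCategory (C : Type u) [Category.{v} C] [MonoidalCategory C] [BraidedCategory C]
    [SymCatGroup C] extends AnnCategory C where
  braiding_dist : ∀ A X Y : C,
    (distL A X Y).hom ≫ ((β_ A X).hom ∔ₘ (β_ A Y).hom) =
      (β_ A (X ∔ Y)).hom ≫ (distR X Y A).hom
  braiding_zero : (β_ (zero C) (zero C)).hom = 𝟙 (zero C ⊗ zero C)

/-! ## Facts about one monoidal category, used for the zero comparison and for `Aut 0` -/

section Generic

variable {C : Type u} [Category.{v} C] [MonoidalCategory C]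

theorem whiskerRight_bijective (h : ∀ X : C, ∃ Y : C, Nonempty (X ⊗ Y ≅ 𝟙_ C)) (A B Z : C) :
    Function.Bijective (fun f : A ⟶ B => f ▷ Z) := by
  have faithful : ∀ (Z A B : C) (f g : A ⟶ B), f ▷ Z = g ▷ Z → f = g := by
    intro Z A B f g hfg
    obtain ⟨Y, ⟨e⟩⟩ := h Z
    have h1 : f ▷ Z ▷ Y = g ▷ Z ▷ Y := by rw [hfg]
    rw [whiskerRight_tensor_symm, whiskerRight_tensor_symm, Iso.cancel_iso_hom_left,
      Iso.cancel_iso_inv_right] at h1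
    have h2 : f ▷ (𝟙_ C) = g ▷ (𝟙_ C) := by
      have k : ∀ f : A ⟶ B, f ▷ (𝟙_ C) = (A ◁ e.inv) ≫ (f ▷ (Z ⊗ Y)) ≫ (B ◁ e.hom) := by
        intro f
        rw [← whisker_exchange, ← whiskerLeft_comp_assoc, e.inv_hom_id, whiskerLeft_id,
          Category.id_comp]
      rw [k f, k g, h1]
    simpa [MonoidalCategory.whiskerRight_id] using h2
  refine ⟨fun f g hfg => faithful Z A B f g hfg, fun k => ?_⟩
  obtain ⟨Y, ⟨e⟩⟩ := h Z
  let φ : ∀ A : C, (A ⊗ Z) ⊗ Y ≅ A := fun A => α_ A Z Y ≪≫ whiskerLeftIso A e ≪≫ ρ_ A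
  have nat : ∀ {A B : C} (f : A ⟶ B), f ▷ Z ▷ Y ≫ (φ B).hom = (φ A).hom ≫ f := by
    intro A B f
    simp only [φ, Iso.trans_hom, whiskerLeftIso_hom, Category.assoc]
    rw [associator_naturality_left_assoc, ← whisker_exchange_assoc]
    simp
  refine ⟨(φ A).inv ≫ k ▷ Y ≫ (φ B).hom, ?_⟩
  apply faithful Y
  rw [← cancel_mono (φ B).hom, nat]
  simp

theorem end_unit_comm (f g : 𝟙_ C ⟶ 𝟙_ C) : f ≫ g = g ≫ f := by
  have hf : f = (ρ_ (𝟙_ C)).inv ≫ f ▷ (𝟙_ C) ≫ (ρ_ (𝟙_ C)).hom := by simp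
  have hg : g = (ρ_ (𝟙_ C)).inv ≫ (𝟙_ C) ◁ g ≫ (ρ_ (𝟙_ C)).hom := by
    rw [MonoidalCategory.id_whiskerLeft, unitors_equal, unitors_inv_equal]; simp
  have h1 : f ≫ g = (ρ_ (𝟙_ C)).inv ≫ (f ▷ (𝟙_ C) ≫ (𝟙_ C) ◁ g) ≫ (ρ_ (𝟙_ C)).hom := by
    conv_lhs => rw [hf, hg]
    simp
  have h2 : g ≫ f = (ρ_ (𝟙_ C)).inv ≫ ((𝟙_ C) ◁ g ≫ f ▷ (𝟙_ C)) ≫ (ρ_ (𝟙_ C)).hom := by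
    conv_lhs => rw [hf, hg]
    simp
  rw [h1, h2, whisker_exchange]

theorem tensorHom_unit_conj (f g : 𝟙_ C ⟶ 𝟙_ C) :
    (λ_ (𝟙_ C)).inv ≫ (f ⊗ₘ g) ≫ (λ_ (𝟙_ C)).hom = f ≫ g := by
  rw [MonoidalCategory.tensorHom_def]
  have : f ▷ (𝟙_ C) = (λ_ (𝟙_ C)).hom ≫ f ≫ (λ_ (𝟙_ C)).inv := by
    rw [unitors_equal, MonoidalCategory.whiskerRight_id, unitors_inv_equal]
  rw [this]
  simp

end Generic

/-! ## The invariants `π₀` and `π₁` -/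

/-- The set of isomorphism classes of objects. -/
def Pi0 (C : Type u) [Category.{v} C] : Type u := Quotient (isIsomorphicSetoid C)

/-- The isomorphism class of an object. -/
def Pi0.mk {C : Type u} [Category.{v} C] (X : C) : Pi0 C := Quotient.mk (isIsomorphicSetoid C) X

theorem Pi0.mk_eq {C : Type u} [Category.{v} C] {X Y : C} (e : X ≅ Y) : Pi0.mk X = Pi0.mk Y :=
  Quotient.sound (s := isIsomorphicSetoid C) ⟨e⟩

/-- The automorphism group of the zero object, written additively. -/
def Pi1 (C : Type u) [Category.{v} C] [SymCatGroup C] : Type v := Additive (Aut (zero C))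

section PlusFacts

variable {C : Type u} [Category.{v} C] [SymCatGroup C]

/-- The automorphism of `0` underlying an element of `Pi1 C`. -/
def Pi1.aut (u : Pi1 C) : zero C ≅ zero C := Additive.toMul u

/-- The element of `Pi1 C` given by an automorphism of `0`. -/
def Pi1.of (e : zero C ≅ zero C) : Pi1 C := Additive.ofMul (e : Aut (zero C))

noncomputable instance : AddCommGroup (Pi1 C) :=
  { (inferInstance : AddGroup (Additive (Aut (zero C)))) with
    add_comm := fun a b => by
      apply Iso.ext
      exact @end_unit_comm C _ SymCatGroup.plus (Pi1.aut b).hom (Pi1.aut a).hom }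

theorem Pi1.ext {a b : Pi1 C} (h : (Pi1.aut a).hom = (Pi1.aut b).hom) : a = b := Iso.ext h

theorem Pi1.aut_add (a b : Pi1 C) :
    (Pi1.aut (a + b)).hom = (Pi1.aut b).hom ≫ (Pi1.aut a).hom := rfl

theorem Pi1.aut_zero : (Pi1.aut (0 : Pi1 C)).hom = 𝟙 (zero C) := rfl

theorem addMap_bijective (A B Z : C) :
    Function.Bijective (fun f : A ⟶ B => f ∔ₘ 𝟙 Z) := by
  have h := @whiskerRight_bijective C _ SymCatGroup.plus SymCatGroup.exists_neg A B Z
  have e : (fun f : A ⟶ B => f ∔ₘ 𝟙 Z) =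
      (fun f : A ⟶ B => (SymCatGroup.plus (C := C)).whiskerRight f Z) := by
    funext f
    exact @MonoidalCategory.tensorHom_id C _ SymCatGroup.plus _ _ f Z
  rw [e]
  exact h

/-- The automorphism `γ_X(u)` of `X` given by `γ_X(u) ∘ g_X = g_X ∘ (u + id_X)`. -/
def gammaMap (X : C) (u : Pi1 C) : X ⟶ X :=
  (zeroAdd X).inv ≫ ((Pi1.aut u).hom ∔ₘ 𝟙 X) ≫ (zeroAdd X).hom

theorem gammaMap_bijective (X : C) : Function.Bijective (gammaMap X) := by
  have h := addMap_bijective (zero C) (zero C) X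
  constructor
  · intro a b hab
    apply Pi1.ext
    apply h.1
    have h1 := hab
    unfold gammaMap at h1
    rw [Iso.cancel_iso_inv_left, Iso.cancel_iso_hom_right] at h1
    exact h1
  · intro k
    obtain ⟨f, hf⟩ := h.2 ((zeroAdd X).hom ≫ k ≫ (zeroAdd X).inv)
    refine ⟨Pi1.of (asIso f), ?_⟩
    change (zeroAdd X).inv ≫ (f ∔ₘ 𝟙 X) ≫ (zeroAdd X).hom = k
    have hf' : (f ∔ₘ 𝟙 X) = (zeroAdd X).hom ≫ k ≫ (zeroAdd X).inv := hf
    rw [hf']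
    simp

/-- The bijection `γ_X` from `Aut 0` to the (auto)morphisms of `X`. -/
noncomputable def gamma (X : C) : Pi1 C ≃ (X ⟶ X) :=
  Equiv.ofBijective (gammaMap X) (gammaMap_bijective X)

theorem existsUnique_toZero {Z : C} (e : Z ∔ Z ≅ Z) :
    ∃! h : Z ≅ zero C, (h.hom ∔ₘ 𝟙 Z) ≫ (zeroAdd Z).hom = e.hom := by
  obtain ⟨f, hf⟩ := (addMap_bijective Z (zero C) Z).2 (e.hom ≫ (zeroAdd Z).inv)
  have hf' : (f ∔ₘ 𝟙 Z) = e.hom ≫ (zeroAdd Z).inv := hf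
  refine ⟨asIso f, ?_, ?_⟩
  · change (f ∔ₘ 𝟙 Z) ≫ (zeroAdd Z).hom = e.hom
    rw [hf']
    simp
  · intro y hy
    apply Iso.ext
    apply (addMap_bijective Z (zero C) Z).1
    change (y.hom ∔ₘ 𝟙 Z) = (f ∔ₘ 𝟙 Z)
    have hy' : (y.hom ∔ₘ 𝟙 Z) ≫ (zeroAdd Z).hom = e.hom := hy
    rw [hf', ← hy']
    simp

/-- The isomorphism `h : Z ⟶ 0` induced by an isomorphism `e : Z + Z ⟶ Z`: the unique one with
`g_Z ∘ (h + id_Z) = e`. -/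
noncomputable def toZero {Z : C} (e : Z ∔ Z ≅ Z) : Z ≅ zero C :=
  Classical.choose (existsUnique_toZero e)

theorem toZero_spec {Z : C} (e : Z ∔ Z ≅ Z) :
    ((toZero e).hom ∔ₘ 𝟙 Z) ≫ (zeroAdd Z).hom = e.hom :=
  (Classical.choose_spec (existsUnique_toZero e)).1

/-- The sum of two isomorphisms. -/
abbrev addIso {X Y X' Y' : C} (f : X ≅ Y) (g : X' ≅ Y') : X ∔ X' ≅ Y ∔ Y' :=
  @MonoidalCategory.tensorIso C _ SymCatGroup.plus X Y X' Y' f g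

end PlusFacts

section Ann

variable {C : Type u} [Category.{v} C] [MonoidalCategory C] [SymCatGroup C]

/-- The endomorphism of `Aut 0` obtained by conjugating `X ⊗ -` by an isomorphism `X ⊗ 0 ⟶ 0`. -/
def actBy {X : C} (e : X ⊗ zero C ≅ zero C) (u : Pi1 C) : Pi1 C :=
  Pi1.of (e.symm ≪≫ whiskerLeftIso X (Pi1.aut u) ≪≫ e)

theorem actBy_hom {X : C} (e : X ⊗ zero C ≅ zero C) (u : Pi1 C) :
    (Pi1.aut (actBy e u)).hom = e.inv ≫ X ◁ (Pi1.aut u).hom ≫ e.hom := rfl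

theorem actBy_eq {X Y : C} (e : X ⊗ zero C ≅ zero C) (f : Y ⊗ zero C ≅ zero C) (i : X ≅ Y)
    (u : Pi1 C) : actBy e u = actBy f u := by
  apply Pi1.ext
  have h := @end_unit_comm C _ SymCatGroup.plus
    (e.inv ≫ i.hom ▷ zero C ≫ f.hom) (Pi1.aut (actBy f u)).hom
  have h2 : (e.inv ≫ i.hom ▷ zero C ≫ f.hom) ≫ (Pi1.aut (actBy f u)).hom =
      (Pi1.aut (actBy e u)).hom ≫ (e.inv ≫ i.hom ▷ zero C ≫ f.hom) := by
    rw [actBy_hom, actBy_hom]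
    simp only [Category.assoc, Iso.hom_inv_id_assoc]
    rw [whisker_exchange_assoc]
  rw [h2] at h
  exact (cancel_mono (e.inv ≫ i.hom ▷ zero C ≫ f.hom)).1 (h.trans rfl) |>.trans rfl

variable [AnnCategory C]

/-- The canonical isomorphism `X ⊗ 0 ⟶ 0`, through which the sum-preserving functor `X ⊗ -`
preserves the zero object. -/
noncomputable def mulZero (X : C) : X ⊗ zero C ≅ zero C :=
  toZero ((distL X (zero C) (zero C)).symm ≪≫ whiskerLeftIso X (zeroAdd (zero C)))

/-- The canonical isomorphism `0 ⊗ X ⟶ 0`, through which the sum-preserving functor `- ⊗ X`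
preserves the zero object. -/
noncomputable def zeroMul (X : C) : zero C ⊗ X ≅ zero C :=
  toZero ((distR (zero C) (zero C) X).symm ≪≫ whiskerRightIso (zeroAdd (zero C)) X)

/-- The action of an object `X` on `Aut 0`: the automorphism `λ_X(u)` with
`λ_X(u) ∘ mulZero X = mulZero X ∘ (id_X ⊗ u)`. -/
noncomputable def act (X : C) (u : Pi1 C) : Pi1 C := actBy (mulZero X) u

theorem act_eq {X Y : C} (f : Y ⊗ zero C ≅ zero C) (i : X ≅ Y) (u : Pi1 C) :
    act X u = actBy f u := actBy_eq _ f i u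

theorem act_one (u : Pi1 C) : act (𝟙_ C) u = u := by
  rw [act_eq (λ_ (zero C)) (Iso.refl _)]
  apply Pi1.ext
  rw [actBy_hom]
  simp

theorem act_mul (X Y : C) (u : Pi1 C) : act (X ⊗ Y) u = act X (act Y u) := by
  rw [act_eq (α_ X Y (zero C) ≪≫ whiskerLeftIso X (mulZero Y) ≪≫ mulZero X) (Iso.refl _)]
  apply Pi1.ext
  rw [actBy_hom, act, actBy_hom, act, actBy_hom]
  simp

theorem act_zero_right (X : C) : act X (0 : Pi1 C) = 0 := by
  apply Pi1.ext
  rw [act, actBy_hom, Pi1.aut_zero]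
  simp

theorem act_add_right (X : C) (u w : Pi1 C) : act X (u + w) = act X u + act X w := by
  apply Pi1.ext
  rw [Pi1.aut_add, act, actBy_hom, act, actBy_hom, act, actBy_hom, Pi1.aut_add]
  simp

theorem act_add_left (X Y : C) (u : Pi1 C) : act (X ∔ Y) u = act X u + act Y u := by
  rw [act_eq (distR X Y (zero C) ≪≫ addIso (mulZero X) (mulZero Y) ≪≫ zeroAdd (zero C))
    (Iso.refl _)]
  apply Pi1.ext
  rw [actBy_hom, Pi1.aut_add, act, actBy_hom, act, actBy_hom]
  have n := distR_natural (𝟙 X) (𝟙 Y) (Pi1.aut u).hom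
  have hid : (𝟙 X ∔ₘ 𝟙 Y) = 𝟙 (X ∔ Y) :=
    @MonoidalCategory.id_tensorHom_id C _ SymCatGroup.plus X Y
  rw [hid, id_tensorHom, id_tensorHom, id_tensorHom] at n
  have c := @tensorHom_unit_conj C _ SymCatGroup.plus
    ((mulZero X).inv ≫ X ◁ (Pi1.aut u).hom ≫ (mulZero X).hom)
    ((mulZero Y).inv ≫ Y ◁ (Pi1.aut u).hom ≫ (mulZero Y).hom)
  rw [← @MonoidalCategory.tensorHom_comp_tensorHom C _ SymCatGroup.plus,
    ← @MonoidalCategory.tensorHom_comp_tensorHom C _ SymCatGroup.plus] at c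
  rw [@end_unit_comm C _ SymCatGroup.plus] at c
  rw [← c]
  simp only [Iso.trans_inv, Iso.trans_hom, Category.assoc]
  rw [reassoc_of% n]
  simp only [Iso.inv_hom_id_assoc]
  rfl

end Ann

/-! ## The ring `π₀` and its module `π₁` -/

section Braided

variable (C : Type u) [Category.{v} C]

noncomputable instance [SymCatGroup C] : Add (Pi0 C) where
  add := Quotient.map₂ (fun X Y => X ∔ Y) (fun _ _ ⟨e⟩ _ _ ⟨f⟩ => ⟨addIso e f⟩)

noncomputable instance [SymCatGroup C] : Zero (Pi0 C) where
  zero := Pi0.mk (zero C)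

theorem Pi0.exists_neg [SymCatGroup C] (a : Pi0 C) : ∃ b : Pi0 C, a + b = 0 := by
  induction a using Quotient.inductionOn with
  | h X =>
    obtain ⟨Y, ⟨e⟩⟩ := SymCatGroup.exists_neg X
    exact ⟨Pi0.mk Y, Pi0.mk_eq e⟩

noncomputable instance [SymCatGroup C] : Neg (Pi0 C) where
  neg a := Classical.choose (Pi0.exists_neg C a)

noncomputable instance [MonoidalCategory C] : Mul (Pi0 C) where
  mul := Quotient.map₂ (fun X Y => X ⊗ Y) (fun _ _ ⟨e⟩ _ _ ⟨f⟩ => ⟨e ⊗ᵢ f⟩)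

instance [MonoidalCategory C] : One (Pi0 C) where
  one := Pi0.mk (𝟙_ C)

theorem Pi0.add_comm' [SymCatGroup C] (a b : Pi0 C) : a + b = b + a := by
  induction a using Quotient.inductionOn with
  | h X =>
  induction b using Quotient.inductionOn with
  | h Y => exact Pi0.mk_eq (addComm X Y)

variable [MonoidalCategory C] [BraidedCategory C]

theorem Pi0.mul_comm' (a b : Pi0 C) : a * b = b * a := by
  induction a using Quotient.inductionOn with
  | h X =>
  induction b using Quotient.inductionOn with
  | h Y => exact Pi0.mk_eq (β_ X Y)

variable [SymCatGroup C] [BraidedAnnCategory C]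

theorem Pi0.left_distrib' (a b c : Pi0 C) : a * (b + c) = a * b + a * c := by
  induction a using Quotient.inductionOn with
  | h X =>
  induction b using Quotient.inductionOn with
  | h Y =>
  induction c using Quotient.inductionOn with
  | h Z => exact Pi0.mk_eq (distL X Y Z)

theorem Pi0.right_distrib' (a b c : Pi0 C) : (a + b) * c = a * c + b * c := by
  induction a using Quotient.inductionOn with
  | h X =>
  induction b using Quotient.inductionOn with
  | h Y =>
  induction c using Quotient.inductionOn with
  | h Z => exact Pi0.mk_eq (distR X Y Z)

theorem Pi0.mul_zero' (a : Pi0 C) : a * 0 = 0 := by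
  induction a using Quotient.inductionOn with
  | h X => exact Pi0.mk_eq (mulZero X)

/-- The ring of isomorphism classes of objects, with the operations induced by `+` and `⊗`. -/
noncomputable instance : CommRing (Pi0 C) where
  add_assoc a b c := by
    induction a using Quotient.inductionOn with
    | h X =>
    induction b using Quotient.inductionOn with
    | h Y =>
    induction c using Quotient.inductionOn with
    | h Z => exact Pi0.mk_eq (addAssoc X Y Z).symm
  zero_add a := by
    induction a using Quotient.inductionOn with
    | h X => exact Pi0.mk_eq (zeroAdd X)
  add_zero a := by
    induction a using Quotient.inductionOn with
    | h X => exact Pi0.mk_eq (addZero X)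
  nsmul := nsmulRec
  zsmul := zsmulRec
  neg_add_cancel a := by
    rw [Pi0.add_comm']
    exact Classical.choose_spec (Pi0.exists_neg C a)
  add_comm := Pi0.add_comm' C
  mul_assoc a b c := by
    induction a using Quotient.inductionOn with
    | h X =>
    induction b using Quotient.inductionOn with
    | h Y =>
    induction c using Quotient.inductionOn with
    | h Z => exact Pi0.mk_eq (α_ X Y Z)
  one_mul a := by
    induction a using Quotient.inductionOn with
    | h X => exact Pi0.mk_eq (λ_ X)
  mul_one a := by
    induction a using Quotient.inductionOn with
    | h X => exact Pi0.mk_eq (ρ_ X)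
  mul_comm := Pi0.mul_comm' C
  left_distrib := Pi0.left_distrib' C
  right_distrib := Pi0.right_distrib' C
  mul_zero := Pi0.mul_zero' C
  zero_mul a := by
    rw [Pi0.mul_comm']
    exact Pi0.mul_zero' C a

noncomputable instance : SMul (Pi0 C) (Pi1 C) where
  smul a u := Quotient.lift (s := isIsomorphicSetoid C) (fun X : C => act X u)
    (fun X Y (h : Nonempty (X ≅ Y)) => h.elim fun e => act_eq (mulZero Y) e u) a

/-- The module structure of `π₁` over `π₀`: the class of `X` acts by `act X`. -/
noncomputable instance : Module (Pi0 C) (Pi1 C) where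
  one_smul u := act_one u
  mul_smul a b u := by
    induction a using Quotient.inductionOn with
    | h X =>
    induction b using Quotient.inductionOn with
    | h Y => exact act_mul X Y u
  smul_zero a := by
    induction a using Quotient.inductionOn with
    | h X => exact act_zero_right X
  smul_add a u w := by
    induction a using Quotient.inductionOn with
    | h X => exact act_add_right X u w
  add_smul a b u := by
    induction a using Quotient.inductionOn with
    | h X =>
    induction b using Quotient.inductionOn with
    | h Y => exact act_add_left X Y u
  zero_smul u := by
    have h : act (zero C ∔ zero C) u = act (zero C) u + act (zero C) u := act_add_left _ _ u
    have h2 : act (zero C ∔ zero C) u = act (zero C) u :=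
      act_eq (mulZero (zero C)) (zeroAdd (zero C)) u
    rw [h2] at h
    exact left_eq_add.mp h

end Braided

/-! ## Low-dimensional cohomology of a commutative ring -/

section Cohomology

variable (R : Type u) (M : Type v) [CommRing R] [AddCommGroup M] [Module R M]

/-- Mac Lane 3-cochains `h = (ξ, η, α, λ, ρ)`. -/
abbrev MacLaneCochain : Type (max u v) :=
  (R → R → R → M) × (R → R → M) × (R → R → R → M) × (R → R → R → M) × (R → R → R → M)

/-- Pairs `(h, β)` of a Mac Lane 3-cochain `h` and a map `β : R² → M`. -/
abbrev AbCochain : Type (max u v) := MacLaneCochain R M × (R → R → M)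

variable {R M}

namespace MacLaneCochain

/-- The component `ξ`. -/
def xi (h : MacLaneCochain R M) : R → R → R → M := h.1

/-- The component `η`. -/
def eta (h : MacLaneCochain R M) : R → R → M := h.2.1

/-- The component `α`. -/
def alpha (h : MacLaneCochain R M) : R → R → R → M := h.2.2.1

/-- The component `λ`. -/
def lam (h : MacLaneCochain R M) : R → R → R → M := h.2.2.2.1

/-- The component `ρ`. -/
def rho (h : MacLaneCochain R M) : R → R → R → M := h.2.2.2.2

theorem xi_sub (h h' : MacLaneCochain R M) (x y z : R) :
    xi (h - h') x y z = xi h x y z - xi h' x y z := rfl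

theorem xi_zero (x y z : R) : xi (0 : MacLaneCochain R M) x y z = 0 := rfl

theorem eta_sub (h h' : MacLaneCochain R M) (x y : R) :
    eta (h - h') x y = eta h x y - eta h' x y := rfl

theorem eta_zero (x y : R) : eta (0 : MacLaneCochain R M) x y = 0 := rfl

theorem alpha_sub (h h' : MacLaneCochain R M) (x y z : R) :
    alpha (h - h') x y z = alpha h x y z - alpha h' x y z := rfl

theorem alpha_zero (x y z : R) : alpha (0 : MacLaneCochain R M) x y z = 0 := rfl

theorem lam_sub (h h' : MacLaneCochain R M) (x y z : R) :
    lam (h - h') x y z = lam h x y z - lam h' x y z := rfl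

theorem lam_zero (x y z : R) : lam (0 : MacLaneCochain R M) x y z = 0 := rfl

theorem rho_sub (h h' : MacLaneCochain R M) (x y z : R) :
    rho (h - h') x y z = rho h x y z - rho h' x y z := rfl

theorem rho_zero (x y z : R) : rho (0 : MacLaneCochain R M) x y z = 0 := rfl

end MacLaneCochain

open MacLaneCochain

/-- The normalized Mac Lane 3-cocycle conditions, for a commutative ring `R` and an `R`-module `M`
regarded as a bimodule with equal left and right actions. -/
structure IsMacLaneCocycle (h : MacLaneCochain R M) : Prop where
  s1 : ∀ x y z t, xi h y z t - xi h (x + y) z t + xi h x (y + z) t - xi h x y (z + t)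
    + xi h x y z = 0
  s2 : ∀ x y z, xi h x y z - xi h x z y + xi h z x y + eta h (x + y) z - eta h x z
    - eta h y z = 0
  s3 : ∀ x y, eta h x y + eta h y x = 0
  s4 : ∀ x y z, x • eta h y z - eta h (x * y) (x * z) = lam h x y z - lam h x z y
  s5 : ∀ x y z, z • eta h x y - eta h (x * z) (y * z) = rho h x y z - rho h y x z
  s6 : ∀ x y z t, x • xi h y z t - xi h (x * y) (x * z) (x * t) =
    lam h x z t - lam h x (y + z) t + lam h x y (z + t) - lam h x y z
  s7 : ∀ x y z t, t • xi h x y z - xi h (x * t) (y * t) (z * t) =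
    rho h y z t - rho h (x + y) z t + rho h x (y + z) t - rho h x y t
  s8 : ∀ x y z t, rho h x y (z + t) - rho h x y z - rho h x y t + lam h x z t + lam h y z t
      - lam h (x + y) z t =
    - xi h (x * z + x * t) (y * z) (y * t) + xi h (x * z) (x * t) (y * z)
      - eta h (x * t) (y * z) + xi h (x * z + y * z) (x * t) (y * t)
      - xi h (x * z) (y * z) (x * t)
  s9 : ∀ x y z t, alpha h x y (z + t) - alpha h x y z - alpha h x y t =
    x • lam h y z t + lam h x (y * z) (y * t) - lam h (x * y) z t
  s10 : ∀ x y z t, alpha h x (y + z) t - alpha h x y t - alpha h x z t =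
    x • rho h y z t - rho h (x * y) (x * z) t + lam h x (y * t) (z * t) - t • lam h x y z
  s11 : ∀ x y z t, alpha h (x + y) z t - alpha h x z t - alpha h y z t =
    - (t • rho h x y z) - rho h (x * z) (y * z) t + rho h x y (z * t)
  s12 : ∀ x y z t, x • alpha h y z t - alpha h (x * y) z t + alpha h x (y * z) t
    - alpha h x y (z * t) + t • alpha h x y z = 0
  xi_norm : ∀ y z, xi h 0 y z = 0 ∧ xi h y 0 z = 0 ∧ xi h y z 0 = 0
  alpha_norm_one : ∀ y z, alpha h 1 y z = 0 ∧ alpha h y 1 z = 0 ∧ alpha h y z 1 = 0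
  alpha_norm_zero : ∀ y z, alpha h 0 y z = 0 ∧ alpha h y 0 z = 0 ∧ alpha h y z 0 = 0
  lam_norm : ∀ y z, lam h 1 y z = 0 ∧ lam h 0 y z = 0 ∧ lam h y 0 z = 0 ∧ lam h y z 0 = 0
  rho_norm : ∀ y z, rho h y z 1 = 0 ∧ rho h 0 y z = 0 ∧ rho h y 0 z = 0 ∧ rho h y z 0 = 0

/-- The abelian 3-cocycle conditions on a pair `(h, β)`. -/
structure IsAbCocycle (k : AbCochain R M) : Prop where
  macLane : IsMacLaneCocycle k.1
  s20 : ∀ x y z, alpha k.1 x y z - alpha k.1 x z y + alpha k.1 z x y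
    - x • k.2 y z + k.2 (x * y) z - y • k.2 x z = 0
  s21 : ∀ x y z, alpha k.1 x y z - alpha k.1 y x z + alpha k.1 y z x
    + y • k.2 x z - k.2 x (y * z) + z • k.2 x y = 0
  s22 : ∀ x y z, k.2 x y - k.2 x (y + z) + k.2 x z = rho k.1 y z x - lam k.1 x y z

/-- A normalized pair `(μ, ν)` of maps `R² → M`. -/
structure IsNormalized (g : (R → R → M) × (R → R → M)) : Prop where
  mu_norm : ∀ x, g.1 0 x = 0 ∧ g.1 x 0 = 0
  nu_norm : ∀ x, g.2 0 x = 0 ∧ g.2 x 0 = 0 ∧ g.2 1 x = 0 ∧ g.2 x 1 = 0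

/-- The coboundary `∂(μ, ν)`. -/
def coboundary (g : (R → R → M) × (R → R → M)) : AbCochain R M :=
  ((fun x y z => g.1 y z - g.1 (x + y) z + g.1 x (y + z) - g.1 x y,
    fun x y => g.1 x y - g.1 y x,
    fun x y z => x • g.2 y z - g.2 (x * y) z + g.2 x (y * z) - z • g.2 x y,
    fun x y z => g.2 x (y + z) - g.2 x y - g.2 x z + x • g.1 y z - g.1 (x * y) (x * z),
    fun x y z => g.2 (x + y) z - g.2 x z - g.2 y z + z • g.1 x y - g.1 (x * z) (y * z)),
   fun x y => g.2 x y - g.2 y x)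

theorem IsMacLaneCocycle.sub {a b : MacLaneCochain R M} (ha : IsMacLaneCocycle a)
    (hb : IsMacLaneCocycle b) : IsMacLaneCocycle (a - b) where
  s1 x y z t := by
    have h1 := ha.s1 x y z t
    have h2 := hb.s1 x y z t
    simp only [Prod.fst_sub, Prod.snd_sub, Pi.sub_apply, xi_sub, eta_sub, alpha_sub, lam_sub,
      rho_sub]
    linear_combination (norm := module) h1 - h2
  s2 x y z := by
    have h1 := ha.s2 x y z
    have h2 := hb.s2 x y z
    simp only [Prod.fst_sub, Prod.snd_sub, Pi.sub_apply, xi_sub, eta_sub, alpha_sub, lam_sub,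
      rho_sub]
    linear_combination (norm := module) h1 - h2
  s3 x y := by
    have h1 := ha.s3 x y
    have h2 := hb.s3 x y
    simp only [Prod.fst_sub, Prod.snd_sub, Pi.sub_apply, xi_sub, eta_sub, alpha_sub, lam_sub,
      rho_sub]
    linear_combination (norm := module) h1 - h2
  s4 x y z := by
    have h1 := ha.s4 x y z
    have h2 := hb.s4 x y z
    simp only [Prod.fst_sub, Prod.snd_sub, Pi.sub_apply, xi_sub, eta_sub, alpha_sub, lam_sub,
      rho_sub]
    linear_combination (norm := module) h1 - h2
  s5 x y z := by
    have h1 := ha.s5 x y z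
    have h2 := hb.s5 x y z
    simp only [Prod.fst_sub, Prod.snd_sub, Pi.sub_apply, xi_sub, eta_sub, alpha_sub, lam_sub,
      rho_sub]
    linear_combination (norm := module) h1 - h2
  s6 x y z t := by
    have h1 := ha.s6 x y z t
    have h2 := hb.s6 x y z t
    simp only [Prod.fst_sub, Prod.snd_sub, Pi.sub_apply, xi_sub, eta_sub, alpha_sub, lam_sub,
      rho_sub]
    linear_combination (norm := module) h1 - h2
  s7 x y z t := by
    have h1 := ha.s7 x y z t
    have h2 := hb.s7 x y z t
    simp only [Prod.fst_sub, Prod.snd_sub, Pi.sub_apply, xi_sub, eta_sub, alpha_sub, lam_sub,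
      rho_sub]
    linear_combination (norm := module) h1 - h2
  s8 x y z t := by
    have h1 := ha.s8 x y z t
    have h2 := hb.s8 x y z t
    simp only [Prod.fst_sub, Prod.snd_sub, Pi.sub_apply, xi_sub, eta_sub, alpha_sub, lam_sub,
      rho_sub]
    linear_combination (norm := module) h1 - h2
  s9 x y z t := by
    have h1 := ha.s9 x y z t
    have h2 := hb.s9 x y z t
    simp only [Prod.fst_sub, Prod.snd_sub, Pi.sub_apply, xi_sub, eta_sub, alpha_sub, lam_sub,
      rho_sub]
    linear_combination (norm := module) h1 - h2
  s10 x y z t := by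
    have h1 := ha.s10 x y z t
    have h2 := hb.s10 x y z t
    simp only [Prod.fst_sub, Prod.snd_sub, Pi.sub_apply, xi_sub, eta_sub, alpha_sub, lam_sub,
      rho_sub]
    linear_combination (norm := module) h1 - h2
  s11 x y z t := by
    have h1 := ha.s11 x y z t
    have h2 := hb.s11 x y z t
    simp only [Prod.fst_sub, Prod.snd_sub, Pi.sub_apply, xi_sub, eta_sub, alpha_sub, lam_sub,
      rho_sub]
    linear_combination (norm := module) h1 - h2
  s12 x y z t := by
    have h1 := ha.s12 x y z t
    have h2 := hb.s12 x y z t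
    simp only [Prod.fst_sub, Prod.snd_sub, Pi.sub_apply, xi_sub, eta_sub, alpha_sub, lam_sub,
      rho_sub]
    linear_combination (norm := module) h1 - h2
  xi_norm y z := by simp [xi_sub, ha.xi_norm y z, hb.xi_norm y z]
  alpha_norm_one y z := by simp [alpha_sub, ha.alpha_norm_one y z, hb.alpha_norm_one y z]
  alpha_norm_zero y z := by simp [alpha_sub, ha.alpha_norm_zero y z, hb.alpha_norm_zero y z]
  lam_norm y z := by simp [lam_sub, ha.lam_norm y z, hb.lam_norm y z]
  rho_norm y z := by simp [rho_sub, ha.rho_norm y z, hb.rho_norm y z]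

theorem IsMacLaneCocycle.zero : IsMacLaneCocycle (0 : MacLaneCochain R M) := by
  constructor <;> intros <;> simp [xi_zero, eta_zero, alpha_zero, lam_zero, rho_zero]

theorem IsAbCocycle.sub {a b : AbCochain R M} (ha : IsAbCocycle a) (hb : IsAbCocycle b) :
    IsAbCocycle (a - b) where
  macLane := ha.macLane.sub hb.macLane
  s20 x y z := by
    have h1 := ha.s20 x y z
    have h2 := hb.s20 x y z
    simp only [Prod.fst_sub, Prod.snd_sub, Pi.sub_apply, xi_sub, eta_sub, alpha_sub, lam_sub,
      rho_sub]
    linear_combination (norm := module) h1 - h2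
  s21 x y z := by
    have h1 := ha.s21 x y z
    have h2 := hb.s21 x y z
    simp only [Prod.fst_sub, Prod.snd_sub, Pi.sub_apply, xi_sub, eta_sub, alpha_sub, lam_sub,
      rho_sub]
    linear_combination (norm := module) h1 - h2
  s22 x y z := by
    have h1 := ha.s22 x y z
    have h2 := hb.s22 x y z
    simp only [Prod.fst_sub, Prod.snd_sub, Pi.sub_apply, xi_sub, eta_sub, alpha_sub, lam_sub,
      rho_sub]
    linear_combination (norm := module) h1 - h2

theorem IsAbCocycle.zero : IsAbCocycle (0 : AbCochain R M) where
  macLane := IsMacLaneCocycle.zero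
  s20 := by intros; simp [alpha_zero]
  s21 := by intros; simp [alpha_zero]
  s22 := by intros; simp [lam_zero, rho_zero]

theorem IsNormalized.sub {a b : (R → R → M) × (R → R → M)} (ha : IsNormalized a)
    (hb : IsNormalized b) : IsNormalized (a - b) where
  mu_norm x := by simp [ha.mu_norm x, hb.mu_norm x]
  nu_norm x := by simp [ha.nu_norm x, hb.nu_norm x]

theorem coboundary_sub (a b : (R → R → M) × (R → R → M)) :
    coboundary (a - b) = coboundary a - coboundary b := by
  ext <;> simp only [coboundary, Prod.fst_sub, Prod.snd_sub, Pi.sub_apply] <;> module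

variable (R M)

/-- The group of abelian 3-cocycles. -/
def Z3ab : AddSubgroup (AbCochain R M) :=
  AddSubgroup.ofSub {k | IsAbCocycle k} ⟨0, IsAbCocycle.zero⟩
    (fun a ha b hb => by
      rw [← sub_eq_add_neg]
      exact IsAbCocycle.sub ha hb)

/-- The group of coboundaries `∂(μ, ν)` of normalized pairs. -/
def B3ab : AddSubgroup (AbCochain R M) :=
  AddSubgroup.ofSub {k | ∃ g, IsNormalized g ∧ k = coboundary g}
    ⟨coboundary 0, 0, ⟨fun _ => by simp, fun _ => by simp⟩, rfl⟩
    (fun a ha b hb => by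
      obtain ⟨g, hg, rfl⟩ := ha
      obtain ⟨g', hg', rfl⟩ := hb
      rw [← sub_eq_add_neg]
      exact ⟨g - g', hg.sub hg', (coboundary_sub g g').symm⟩)

/-- The third commutative cohomology group of `R` with coefficients in `M`. -/
abbrev H3ab : Type (max u v) := Z3ab R M ⧸ (B3ab R M).addSubgroupOf (Z3ab R M)

variable {R M}

theorem B3ab_le_Z3ab : B3ab R M ≤ Z3ab R M := by
  rintro k ⟨g, hg, rfl⟩
  refine ⟨⟨?_, ?_, ?_, ?_, ?_, ?_, ?_, ?_, ?_, ?_, ?_, ?_, ?_, ?_, ?_, ?_, ?_⟩, ?_, ?_, ?_⟩ <;>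
    intros <;>
    simp only [coboundary, xi, eta, alpha, lam, rho, hg.mu_norm, hg.nu_norm, zero_add, add_zero,
      mul_one, one_mul, mul_zero, zero_mul, mul_add, add_mul] <;>
    (try ring_nf) <;> (try module)
  all_goals simp

theorem Z3ab.isAbCocycle (z : Z3ab R M) : IsAbCocycle z.1 := z.2

theorem Z3ab.isMacLaneCocycle (z : Z3ab R M) : IsMacLaneCocycle z.1.1 := z.2.macLane

end Cohomology

/-! ## Braided Ann-categories of type `(R, M)` -/

section TypeRM

variable {R : Type u} {M : Type v} [CommRing R] [AddCommGroup M] [Module R M]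

/-- The objects of the braided Ann-category of type `(R, M)` with structure `z = (h, β)`: the
elements of `R`.  The structure `z` only enters through the constraints. -/
@[nolint unusedArguments]
def TypeRM (_z : Z3ab R M) : Type u := R

/-- The underlying ring element of an object. -/
def TypeRM.el {z : Z3ab R M} (x : TypeRM z) : R := x

/-- Morphisms `(x, a) : x ⟶ x` with `a` in `M`; there are none between different objects. -/
@[ext]
structure RMHom (M : Type v) (x y : R) where
  eq : x = y
  val : M

variable (z : Z3ab R M)

instance : Category.{v} (TypeRM z) where
  Hom x y := RMHom M x.el y.el
  id x := ⟨rfl, 0⟩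
  comp f g := ⟨f.eq.trans g.eq, f.val + g.val⟩
  id_comp f := RMHom.ext (zero_add _)
  comp_id f := RMHom.ext (add_zero _)
  assoc f g h := RMHom.ext (add_assoc _ _ _)

variable {z}

/-- The morphism with a given component in `M`. -/
def rmHom {x y : TypeRM z} (h : x.el = y.el) (a : M) : x ⟶ y := (⟨h, a⟩ : RMHom M x.el y.el)

/-- The component in `M` of a morphism. -/
def val {x y : TypeRM z} (f : x ⟶ y) : M := RMHom.val f

theorem el_eq {x y : TypeRM z} (f : x ⟶ y) : x.el = y.el := RMHom.eq f

theorem hom_ext {x y : TypeRM z} {f g : x ⟶ y} (h : val f = val g) : f = g := RMHom.ext h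

@[simp] theorem val_comp {x y w : TypeRM z} (f : x ⟶ y) (g : y ⟶ w) :
    val (f ≫ g) = val f + val g := rfl

@[simp] theorem val_id (x : TypeRM z) : val (𝟙 x) = 0 := rfl

@[simp] theorem val_rmHom {x y : TypeRM z} (h : x.el = y.el) (a : M) : val (rmHom h a) = a := rfl

/-- The isomorphism with a given component in `M`. -/
def rmIso {x y : TypeRM z} (h : x.el = y.el) (a : M) : x ≅ y where
  hom := rmHom h a
  inv := rmHom h.symm (-a)
  hom_inv_id := hom_ext (add_neg_cancel a)
  inv_hom_id := hom_ext (neg_add_cancel a)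

@[simp] theorem val_rmIso_hom {x y : TypeRM z} (h : x.el = y.el) (a : M) :
    val (rmIso h a).hom = a := rfl

@[simp] theorem val_rmIso_inv {x y : TypeRM z} (h : x.el = y.el) (a : M) :
    val (rmIso h a).inv = -a := rfl

/-- An element of `R` as an object. -/
def TypeRM.ofEl (z : Z3ab R M) (x : R) : TypeRM z := x

@[simp] theorem TypeRM.el_ofEl (x : R) : (TypeRM.ofEl z x).el = x := rfl

theorem val_inv {x y : TypeRM z} (f : x ≅ y) : val f.inv = - val f.hom := by
  have h : val (f.hom ≫ f.inv) = 0 := by rw [f.hom_inv_id, val_id]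
  rw [val_comp] at h
  exact (neg_eq_of_add_eq_zero_right h).symm

end TypeRM

open MacLaneCochain

section TypeRMPlus

variable {R : Type u} {M : Type v} [CommRing R] [AddCommGroup M] [Module R M] (z : Z3ab R M)

/-- The sum: `x + y` on objects and `(x, a) + (y, b) = (x + y, a + b)` on morphisms, with
associativity constraint `ξ : x + (y + z) ⟶ (x + y) + z` and strict units. -/
@[reducible]
def rmPlusStruct : MonoidalCategoryStruct (TypeRM z) where
  tensorObj x y := TypeRM.ofEl z (x.el + y.el)
  whiskerLeft x _ _ f := rmHom (congrArg (x.el + ·) (el_eq f)) (val f)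
  whiskerRight f y := rmHom (congrArg (· + y.el) (el_eq f)) (val f)
  tensorHom f g := rmHom (congrArg₂ (· + ·) (el_eq f) (el_eq g)) (val f + val g)
  tensorUnit := TypeRM.ofEl z 0
  associator x y w := (rmIso (add_assoc x.el y.el w.el).symm (xi z.1.1 x.el y.el w.el)).symm
  leftUnitor x := rmIso (zero_add x.el) 0
  rightUnitor x := rmIso (add_zero x.el) 0

attribute [local instance] rmPlusStruct

variable {z}

theorem el_sum (x y : TypeRM z) : (x ⊗ y).el = x.el + y.el := rfl

theorem el_sumUnit : (𝟙_ (TypeRM z)).el = 0 := rfl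

theorem val_sumLeft (x : TypeRM z) {y w : TypeRM z} (f : y ⟶ w) : val (x ◁ f) = val f := rfl

theorem val_sumRight {x y : TypeRM z} (f : x ⟶ y) (w : TypeRM z) : val (f ▷ w) = val f := rfl

theorem val_sumHom {x y x' y' : TypeRM z} (f : x ⟶ y) (g : x' ⟶ y') :
    val (f ⊗ₘ g) = val f + val g := rfl

theorem val_sumAssoc (x y w : TypeRM z) :
    val (α_ x y w).hom = - xi z.1.1 x.el y.el w.el := rfl

theorem val_sumLeftUnitor (x : TypeRM z) : val (λ_ x).hom = 0 := rfl

theorem val_sumRightUnitor (x : TypeRM z) : val (ρ_ x).hom = 0 := rfl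

variable (z)

/-- The monoidal structure given by the sum. -/
@[reducible]
def rmPlus : MonoidalCategory (TypeRM z) where
  toMonoidalCategoryStruct := rmPlusStruct z
  tensorHom_def f g := hom_ext (by simp [val_sumHom, val_sumLeft, val_sumRight])
  id_tensorHom_id x y := hom_ext (by simp [val_sumHom])
  tensorHom_comp_tensorHom f f' g g' := hom_ext (by simp only [val_comp, val_sumHom]; abel)
  whiskerLeft_id x y := hom_ext (by simp [val_sumLeft])
  id_whiskerRight x y := hom_ext (by simp [val_sumRight])
  associator_naturality f f' f'' := hom_ext (by
    simp only [val_comp, val_sumHom, val_sumAssoc, el_eq f, el_eq f', el_eq f'']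
    abel)
  leftUnitor_naturality f := hom_ext (by
    simp [val_sumLeft, val_sumLeftUnitor])
  rightUnitor_naturality f := hom_ext (by
    simp [val_sumRight, val_sumRightUnitor])
  pentagon x y w t := hom_ext (by
    have h := (Z3ab.isMacLaneCocycle z).s1 x.el y.el w.el t.el
    simp only [val_comp, val_sumLeft, val_sumRight, val_sumAssoc, el_sum]
    linear_combination (norm := module) -h)
  triangle x y := hom_ext (by
    have h := ((Z3ab.isMacLaneCocycle z).xi_norm x.el y.el).2.1
    simp [val_sumLeft, val_sumRight, val_sumAssoc, val_sumLeftUnitor, val_sumRightUnitor,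
      el_sumUnit, h])

attribute [local instance] rmPlus

/-- The symmetry of the sum, with component `η`. -/
@[reducible]
def rmPlusSymm : SymmetricCategory (TypeRM z) where
  braiding x y := rmIso (add_comm x.el y.el) (eta z.1.1 x.el y.el)
  braiding_naturality_right x _ _ f := hom_ext (by
    rw [val_comp, val_comp, val_sumLeft, val_sumRight]
    change val f + eta z.1.1 _ _ = eta z.1.1 _ _ + val f
    rw [el_eq f, _root_.add_comm])
  braiding_naturality_left f x := hom_ext (by
    rw [val_comp, val_comp, val_sumLeft, val_sumRight]
    change val f + eta z.1.1 _ _ = eta z.1.1 _ _ + val f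
    rw [el_eq f, _root_.add_comm])
  hexagon_forward x y w := hom_ext (by
    have h := (Z3ab.isMacLaneCocycle z).s2 y.el w.el x.el
    have h1 := (Z3ab.isMacLaneCocycle z).s3 x.el (y.el + w.el)
    have h2 := (Z3ab.isMacLaneCocycle z).s3 x.el y.el
    have h3 := (Z3ab.isMacLaneCocycle z).s3 x.el w.el
    simp only [val_comp, val_sumLeft, val_sumRight, val_sumAssoc]
    change - xi z.1.1 x.el y.el w.el + (eta z.1.1 x.el (y.el + w.el) +
      - xi z.1.1 y.el w.el x.el) = eta z.1.1 x.el y.el + (- xi z.1.1 y.el x.el w.el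
        + eta z.1.1 x.el w.el)
    linear_combination (norm := module) h1 - h2 - h3 - h)
  hexagon_reverse x y w := hom_ext (by
    have h := (Z3ab.isMacLaneCocycle z).s2 x.el y.el w.el
    simp only [val_comp, val_sumLeft, val_sumRight, val_sumAssoc, val_inv]
    change - - xi z.1.1 x.el y.el w.el + (eta z.1.1 (x.el + y.el) w.el +
      - - xi z.1.1 w.el x.el y.el) = eta z.1.1 y.el w.el + (- - xi z.1.1 x.el w.el y.el
        + eta z.1.1 x.el w.el)
    linear_combination (norm := module) h)
  symmetry x y := hom_ext ((Z3ab.isMacLaneCocycle z).s3 x.el y.el)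

end TypeRMPlus

section TypeRMTimes

variable {R : Type u} {M : Type v} [CommRing R] [AddCommGroup M] [Module R M] (z : Z3ab R M)

instance : SymCatGroup (TypeRM z) where
  plus := rmPlus z
  plusSymm := rmPlusSymm z
  isGroupoid := ⟨fun f => ⟨rmHom (el_eq f).symm (- val f), hom_ext (add_neg_cancel (val f)),
    hom_ext (neg_add_cancel (val f))⟩⟩
  exists_neg x := ⟨TypeRM.ofEl z (- x.el), ⟨rmIso (add_neg_cancel x.el) 0⟩⟩

/-- The product: `xy` on objects and `(x, a) ⊗ (y, b) = (xy, xb + ya)` on morphisms, with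
associativity constraint `α : x(yz) ⟶ (xy)z` and strict units. -/
instance : MonoidalCategoryStruct (TypeRM z) where
  tensorObj x y := TypeRM.ofEl z (x.el * y.el)
  whiskerLeft x _ _ f := rmHom (congrArg (x.el * ·) (el_eq f)) (x.el • val f)
  whiskerRight f y := rmHom (congrArg (· * y.el) (el_eq f)) (y.el • val f)
  tensorHom {x _ x' _} f g := rmHom (congrArg₂ (· * ·) (el_eq f) (el_eq g))
    (x.el • val g + x'.el • val f)
  tensorUnit := TypeRM.ofEl z 1
  associator x y w := (rmIso (mul_assoc x.el y.el w.el).symm (alpha z.1.1 x.el y.el w.el)).symm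
  leftUnitor x := rmIso (one_mul x.el) 0
  rightUnitor x := rmIso (mul_one x.el) 0

variable {z}

theorem el_add (x y : TypeRM z) : (x ∔ y).el = x.el + y.el := rfl

theorem val_addMap {x y x' y' : TypeRM z} (f : x ⟶ y) (g : x' ⟶ y') :
    val (f ∔ₘ g) = val f + val g := rfl

theorem val_addAssoc (x y w : TypeRM z) :
    val (addAssoc x y w).hom = xi z.1.1 x.el y.el w.el := rfl

theorem val_addComm (x y : TypeRM z) : val (addComm x y).hom = eta z.1.1 x.el y.el := rfl

theorem val_addSwap (x y w t : TypeRM z) :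
    val (addSwap x y w t) = - xi z.1.1 x.el y.el (w.el + t.el) + (xi z.1.1 y.el w.el t.el +
      (eta z.1.1 y.el w.el + (- xi z.1.1 w.el y.el t.el + xi z.1.1 x.el w.el (y.el + t.el)))) := rfl

theorem el_mul (x y : TypeRM z) : (x ⊗ y).el = x.el * y.el := rfl

theorem el_one : (𝟙_ (TypeRM z)).el = 1 := rfl

theorem val_whiskerLeft (x : TypeRM z) {y w : TypeRM z} (f : y ⟶ w) :
    val (x ◁ f) = x.el • val f := rfl

theorem val_whiskerRight {x y : TypeRM z} (f : x ⟶ y) (w : TypeRM z) :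
    val (f ▷ w) = w.el • val f := rfl

theorem val_tensorHom {x y x' y' : TypeRM z} (f : x ⟶ y) (g : x' ⟶ y') :
    val (f ⊗ₘ g) = x.el • val g + x'.el • val f := rfl

theorem val_associator (x y w : TypeRM z) :
    val (α_ x y w).hom = - alpha z.1.1 x.el y.el w.el := rfl

theorem val_leftUnitor (x : TypeRM z) : val (λ_ x).hom = 0 := rfl

theorem val_rightUnitor (x : TypeRM z) : val (ρ_ x).hom = 0 := rfl

variable (z)

instance : MonoidalCategory (TypeRM z) where
  tensorHom_def f g := hom_ext (by
    simp only [val_comp, val_tensorHom, val_whiskerLeft, val_whiskerRight, el_eq f]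
    exact _root_.add_comm _ _)
  id_tensorHom_id x y := hom_ext (by simp [val_tensorHom])
  tensorHom_comp_tensorHom f f' g g' := hom_ext (by
    simp only [val_comp, val_tensorHom, el_eq f, el_eq f']
    module)
  whiskerLeft_id x y := hom_ext (by simp [val_whiskerLeft])
  id_whiskerRight x y := hom_ext (by simp [val_whiskerRight])
  associator_naturality f f' f'' := hom_ext (by
    simp only [val_comp, val_tensorHom, val_associator, el_mul, el_eq f, el_eq f', el_eq f'']
    module)
  leftUnitor_naturality f := hom_ext (by simp [val_whiskerLeft, val_leftUnitor, el_one])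
  rightUnitor_naturality f := hom_ext (by simp [val_whiskerRight, val_rightUnitor, el_one])
  pentagon x y w t := hom_ext (by
    have h := (Z3ab.isMacLaneCocycle z).s12 x.el y.el w.el t.el
    simp only [val_comp, val_whiskerLeft, val_whiskerRight, val_associator, el_mul]
    linear_combination (norm := module) -h)
  triangle x y := hom_ext (by
    have h := ((Z3ab.isMacLaneCocycle z).alpha_norm_one x.el y.el).2.1
    simp [val_whiskerLeft, val_whiskerRight, val_associator, val_leftUnitor, val_rightUnitor,
      el_one, h])

/-- The braiding isomorphism, with component `β`. -/
def rmBraid {z : Z3ab R M} (x y : TypeRM z) : x ⊗ y ≅ y ⊗ x :=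
  rmIso (mul_comm x.el y.el) (z.1.2 x.el y.el)

/-- The left distributivity isomorphism, with component `λ`. -/
def rmDistL {z : Z3ab R M} (a x y : TypeRM z) : a ⊗ (x ∔ y) ≅ (a ⊗ x) ∔ (a ⊗ y) :=
  rmIso (mul_add a.el x.el y.el) (lam z.1.1 a.el x.el y.el)

/-- The right distributivity isomorphism, with component `ρ`. -/
def rmDistR {z : Z3ab R M} (x y a : TypeRM z) : (x ∔ y) ⊗ a ≅ (x ⊗ a) ∔ (y ⊗ a) :=
  rmIso (add_mul x.el y.el a.el) (rho z.1.1 x.el y.el a.el)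

variable {z}

theorem val_rmBraid (x y : TypeRM z) : val (rmBraid x y).hom = z.1.2 x.el y.el := rfl

theorem val_rmDistL (a x y : TypeRM z) :
    val (rmDistL a x y).hom = lam z.1.1 a.el x.el y.el := rfl

theorem val_rmDistR (x y a : TypeRM z) :
    val (rmDistR x y a).hom = rho z.1.1 x.el y.el a.el := rfl

variable (z)

/-- The braiding, with component `β`. -/
instance : BraidedCategory (TypeRM z) where
  braiding x y := rmBraid x y
  braiding_naturality_right x _ _ f := hom_ext (by
    simp only [val_comp, val_whiskerLeft, val_whiskerRight, val_rmBraid, val_rmDistL, val_rmDistR, el_eq f]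
    exact _root_.add_comm _ _)
  braiding_naturality_left f x := hom_ext (by
    simp only [val_comp, val_whiskerLeft, val_whiskerRight, val_rmBraid, val_rmDistL, val_rmDistR, el_eq f]
    exact _root_.add_comm _ _)
  hexagon_forward x y w := hom_ext (by
    have h := (Z3ab.isAbCocycle z).s21 x.el y.el w.el
    simp only [val_comp, val_whiskerLeft, val_whiskerRight, val_associator, val_rmBraid, val_rmDistL, val_rmDistR, el_mul]
    linear_combination (norm := module) -h)
  hexagon_reverse x y w := hom_ext (by
    have h := (Z3ab.isAbCocycle z).s20 x.el y.el w.el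
    simp only [val_comp, val_whiskerLeft, val_whiskerRight, val_associator, val_inv,
      val_rmBraid, val_rmDistL, val_rmDistR, el_mul]
    linear_combination (norm := module) h)

variable {z}

theorem val_braiding (x y : TypeRM z) : val (β_ x y).hom = z.1.2 x.el y.el := rfl

variable (z)

/-- The braided Ann-category of type `(R, M)` with structure `z = (h, β)`; the distributivity
constraints are the components `λ` and `ρ` of `h`. -/
instance : BraidedAnnCategory (TypeRM z) where
  distL a x y := rmDistL a x y
  distR x y a := rmDistR x y a
  distL_natural f g h := hom_ext (by
    simp only [val_comp, val_tensorHom, val_addMap, val_rmBraid, val_rmDistL, val_rmDistR, el_add, el_eq f, el_eq g,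
      el_eq h]
    module)
  distR_natural g h f := hom_ext (by
    simp only [val_comp, val_tensorHom, val_addMap, val_rmBraid, val_rmDistL, val_rmDistR, el_add, el_eq f, el_eq g,
      el_eq h]
    module)
  distL_assoc a x y w := hom_ext (by
    have h := (Z3ab.isMacLaneCocycle z).s6 a.el x.el y.el w.el
    simp only [val_comp, val_addMap, val_whiskerLeft, val_addAssoc, val_rmBraid, val_rmDistL, val_rmDistR, el_add, el_mul,
      val_id]
    linear_combination (norm := module) h)
  distL_comm a x y := hom_ext (by
    have h := (Z3ab.isMacLaneCocycle z).s4 a.el x.el y.el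
    simp only [val_comp, val_whiskerLeft, val_addComm, val_rmBraid, val_rmDistL, val_rmDistR, el_mul]
    linear_combination (norm := module) h)
  distR_assoc x y w a := hom_ext (by
    have h := (Z3ab.isMacLaneCocycle z).s7 x.el y.el w.el a.el
    simp only [val_comp, val_addMap, val_whiskerRight, val_addAssoc, val_rmBraid, val_rmDistL, val_rmDistR, el_add, el_mul,
      val_id]
    linear_combination (norm := module) h)
  distR_comm x y a := hom_ext (by
    have h := (Z3ab.isMacLaneCocycle z).s5 x.el y.el a.el
    simp only [val_comp, val_whiskerRight, val_addComm, val_rmBraid, val_rmDistL, val_rmDistR, el_mul]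
    linear_combination (norm := module) h)
  distL_mul a b x y := hom_ext (by
    have h := (Z3ab.isMacLaneCocycle z).s9 a.el b.el x.el y.el
    simp only [val_comp, val_addMap, val_whiskerLeft, val_associator, val_inv, val_rmBraid, val_rmDistL, val_rmDistR,
      el_add, el_mul]
    linear_combination (norm := module) h)
  distR_mul x y b a := hom_ext (by
    have h := (Z3ab.isMacLaneCocycle z).s11 x.el y.el b.el a.el
    simp only [val_comp, val_addMap, val_whiskerRight, val_associator, val_inv, val_rmBraid, val_rmDistL, val_rmDistR,
      el_add, el_mul]
    linear_combination (norm := module) -h)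
  distL_distR a x y b := hom_ext (by
    have h := (Z3ab.isMacLaneCocycle z).s10 a.el x.el y.el b.el
    simp only [val_comp, val_addMap, val_whiskerLeft, val_whiskerRight, val_associator, val_inv,
      val_rmBraid, val_rmDistL, val_rmDistR, el_add, el_mul]
    linear_combination (norm := module) h)
  dist_swap a b x y := hom_ext (by
    have h := (Z3ab.isMacLaneCocycle z).s8 a.el b.el x.el y.el
    have h1 := (Z3ab.isMacLaneCocycle z).s1 (a.el * x.el) (b.el * x.el) (a.el * y.el)
      (b.el * y.el)
    have h2 := (Z3ab.isMacLaneCocycle z).s1 (a.el * x.el) (a.el * y.el) (b.el * x.el)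
      (b.el * y.el)
    have h3 := (Z3ab.isMacLaneCocycle z).s3 (a.el * y.el) (b.el * x.el)
    have e : b.el * x.el + a.el * y.el = a.el * y.el + b.el * x.el := _root_.add_comm _ _
    rw [e] at h1
    simp only [val_comp, val_addMap, val_addSwap, val_rmBraid, val_rmDistL, val_rmDistR, el_add, el_mul]
    linear_combination (norm := module) h1 - h2 + h3 - h)
  distL_one x y := hom_ext (by
    have h := ((Z3ab.isMacLaneCocycle z).lam_norm x.el y.el).1
    simp [val_addMap, val_leftUnitor, el_one, val_rmDistL, h])
  distR_one x y := hom_ext (by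
    have h := ((Z3ab.isMacLaneCocycle z).rho_norm x.el y.el).1
    simp [val_addMap, val_rightUnitor, el_one, val_rmDistR, h])
  braiding_dist a x y := hom_ext (by
    have h := (Z3ab.isAbCocycle z).s22 a.el x.el y.el
    simp only [val_comp, val_addMap, val_braiding, val_rmBraid, val_rmDistL, val_rmDistR, el_add]
    linear_combination (norm := module) h)
  braiding_zero := hom_ext (by
    have h := (Z3ab.isAbCocycle z).s22 (0 : R) 0 0
    rw [((Z3ab.isMacLaneCocycle z).rho_norm _ _).2.1,
      ((Z3ab.isMacLaneCocycle z).lam_norm _ _).2.1] at h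
    simp only [sub_self, zero_add, add_zero, mul_zero] at h
    exact h)

/-- The functor between two braided Ann-categories of the same type which is the identity on the
common underlying category. -/
def idFunctor (z z' : Z3ab R M) : TypeRM z ⥤ TypeRM z' where
  obj x := TypeRM.ofEl z' x.el
  map f := rmHom (el_eq f) (val f)
  map_id _ := rfl
  map_comp _ _ := rfl

end TypeRMTimes

/-! ## Braided Ann-functors -/

section Functors

variable {C : Type u} [Category.{v} C] {D : Type u₁} [Category.{v₁} D]
  {E : Type u₂} [Category.{v₂} E]

/-- The structure of a symmetric monoidal functor with respect to the sums. -/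
abbrev PlusBraided [SymCatGroup C] [SymCatGroup D] (F : C ⥤ D) :=
  @Functor.Braided C _ SymCatGroup.plus SymCatGroup.plusSymm.toBraidedCategory
    D _ SymCatGroup.plus SymCatGroup.plusSymm.toBraidedCategory F

/-- The natural isomorphism `F X + F Y ⟶ F (X + Y)`. -/
abbrev sumComparison [SymCatGroup C] [SymCatGroup D] (F : C ⥤ D) (hF : PlusBraided F) (X Y : C) :
    F.obj X ∔ F.obj Y ⟶ F.obj (X ∔ Y) :=
  @Functor.LaxMonoidal.μ C _ SymCatGroup.plus D _ SymCatGroup.plus F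
    hF.toMonoidal.toLaxMonoidal X Y

/-- The natural isomorphism `F X ⊗ F Y ⟶ F (X ⊗ Y)`. -/
abbrev prodComparison [MonoidalCategory C] [BraidedCategory C] [MonoidalCategory D]
    [BraidedCategory D] (F : C ⥤ D) (hF : F.Braided) (X Y : C) :
    F.obj X ⊗ F.obj Y ⟶ F.obj (X ⊗ Y) :=
  @Functor.LaxMonoidal.μ C _ _ D _ _ F hF.toMonoidal.toLaxMonoidal X Y

/-- The condition that a natural transformation is a monoidal transformation with respect to the
sums. -/
abbrev IsPlusMonoidal [SymCatGroup C] [SymCatGroup D] {F G : C ⥤ D} (hF : PlusBraided F)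
    (hG : PlusBraided G) (τ : F ⟶ G) : Prop :=
  @NatTrans.IsMonoidal C _ SymCatGroup.plus D _ SymCatGroup.plus F G τ
    hF.toMonoidal.toLaxMonoidal hG.toMonoidal.toLaxMonoidal

/-- The condition that a natural transformation is a monoidal transformation with respect to the
products. -/
abbrev IsProdMonoidal [MonoidalCategory C] [BraidedCategory C] [MonoidalCategory D]
    [BraidedCategory D] {F G : C ⥤ D} (hF : F.Braided) (hG : G.Braided) (τ : F ⟶ G) : Prop :=
  @NatTrans.IsMonoidal C _ _ D _ _ F G τ hF.toMonoidal.toLaxMonoidal hG.toMonoidal.toLaxMonoidal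

variable [MonoidalCategory C] [BraidedCategory C] [SymCatGroup C] [BraidedAnnCategory C]
  [MonoidalCategory D] [BraidedCategory D] [SymCatGroup D] [BraidedAnnCategory D]
  [MonoidalCategory E] [BraidedCategory E] [SymCatGroup E] [BraidedAnnCategory E]

/-- A braided Ann-functor. -/
structure BrAnnFunctor (C : Type u) [Category.{v} C] [MonoidalCategory C] [BraidedCategory C]
    [SymCatGroup C] [BraidedAnnCategory C] (D : Type u₁) [Category.{v₁} D] [MonoidalCategory D]
    [BraidedCategory D] [SymCatGroup D] [BraidedAnnCategory D] where
  /-- the underlying functor -/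
  functor : C ⥤ D
  /-- a symmetric monoidal functor for the sums -/
  plusBraided : PlusBraided functor
  /-- a braided monoidal functor for the products -/
  prodBraided : functor.Braided
  map_distL : ∀ X Y Z : C,
    (𝟙 (functor.obj X) ⊗ₘ sumComparison functor plusBraided Y Z) ≫
        prodComparison functor prodBraided X (Y ∔ Z) ≫ functor.map (distL X Y Z).hom =
      (distL (functor.obj X) (functor.obj Y) (functor.obj Z)).hom ≫
        (prodComparison functor prodBraided X Y ∔ₘ prodComparison functor prodBraided X Z) ≫
          sumComparison functor plusBraided (X ⊗ Y) (X ⊗ Z)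
  map_distR : ∀ X Y Z : C,
    (sumComparison functor plusBraided X Y ⊗ₘ 𝟙 (functor.obj Z)) ≫
        prodComparison functor prodBraided (X ∔ Y) Z ≫ functor.map (distR X Y Z).hom =
      (distR (functor.obj X) (functor.obj Y) (functor.obj Z)).hom ≫
        (prodComparison functor prodBraided X Z ∔ₘ prodComparison functor prodBraided Y Z) ≫
          sumComparison functor plusBraided (X ⊗ Z) (Y ⊗ Z)

namespace BrAnnFunctor

/-- The identity functor, as a symmetric monoidal functor for the sums. -/
abbrev plusId (C : Type u) [Category.{v} C] [SymCatGroup C] : PlusBraided (𝟭 C) :=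
  @Functor.Braided.instId C _ SymCatGroup.plus SymCatGroup.plusSymm.toBraidedCategory

/-- The composition of braided Ann-functors, as a symmetric monoidal functor for the sums. -/
abbrev plusComp (F : BrAnnFunctor C D) (K : BrAnnFunctor D E) :
    PlusBraided (F.functor ⋙ K.functor) :=
  @Functor.Braided.instComp C _ SymCatGroup.plus SymCatGroup.plusSymm.toBraidedCategory
    D _ SymCatGroup.plus SymCatGroup.plusSymm.toBraidedCategory
    E _ SymCatGroup.plus SymCatGroup.plusSymm.toBraidedCategory
    F.functor K.functor F.plusBraided K.plusBraided

/-- The composition of braided Ann-functors, as a braided monoidal functor for the products. -/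
abbrev prodComp (F : BrAnnFunctor C D) (K : BrAnnFunctor D E) :
    (F.functor ⋙ K.functor).Braided :=
  @Functor.Braided.instComp C _ _ _ D _ _ _ E _ _ _
    F.functor K.functor F.prodBraided K.prodBraided

/-- The condition that an isomorphism from `K ∘ F` to the identity is a braided Ann-morphism. -/
def IsHomotopyToId (F : BrAnnFunctor C D) (K : BrAnnFunctor D C)
    (τ : F.functor ⋙ K.functor ≅ 𝟭 C) : Prop :=
  IsPlusMonoidal (plusComp F K) (plusId C) τ.hom ∧
    IsProdMonoidal (prodComp F K) Functor.Braided.instId τ.hom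

/-- A braided Ann-functor `F` is a braided Ann-equivalence if there are a braided Ann-functor `K`
in the other direction and invertible braided Ann-morphisms from `K ∘ F` and `F ∘ K` to the
identities. -/
def IsEquivalence (F : BrAnnFunctor C D) : Prop :=
  ∃ K : BrAnnFunctor D C,
    (∃ τ : F.functor ⋙ K.functor ≅ 𝟭 C, IsHomotopyToId F K τ) ∧
      ∃ σ : K.functor ⋙ F.functor ≅ 𝟭 D, IsHomotopyToId K F σ

end BrAnnFunctor

end Functors

/-! ## Sticks and reduced braided Ann-categories -/

section Sticks

/-- A stick: a representative `obj s` of every isomorphism class `s`, with `obj 0 = 0` and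
`obj 1 = 1`, and isomorphisms `phi s t : X_s + X_t ⟶ X_(s+t)` and `psi s t : X_s X_t ⟶ X_(st)`
that are the canonical ones when `s` or `t` is a unit, or when, for `psi`, one of them is zero. -/
structure Stick (A : Type u) [Category.{v} A] [MonoidalCategory A] [BraidedCategory A]
    [SymCatGroup A] [BraidedAnnCategory A] where
  obj : Pi0 A → A
  mk_obj : ∀ s, Pi0.mk (obj s) = s
  obj_zero : obj 0 = zero A
  obj_one : obj 1 = 𝟙_ A
  phi : ∀ s t : Pi0 A, obj s ∔ obj t ≅ obj (s + t)
  psi : ∀ s t : Pi0 A, obj s ⊗ obj t ≅ obj (s * t)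
  phi_zero_left : ∀ t : Pi0 A, (phi 0 t).hom =
    eqToHom (congrArg (fun X : A => X ∔ obj t) obj_zero) ≫ (zeroAdd (obj t)).hom ≫
      eqToHom (congrArg obj (zero_add t).symm)
  phi_zero_right : ∀ s : Pi0 A, (phi s 0).hom =
    eqToHom (congrArg (fun X : A => obj s ∔ X) obj_zero) ≫ (addZero (obj s)).hom ≫
      eqToHom (congrArg obj (add_zero s).symm)
  psi_one_left : ∀ t : Pi0 A, (psi 1 t).hom =
    eqToHom (congrArg (fun X : A => X ⊗ obj t) obj_one) ≫ (λ_ (obj t)).hom ≫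
      eqToHom (congrArg obj (one_mul t).symm)
  psi_one_right : ∀ s : Pi0 A, (psi s 1).hom =
    eqToHom (congrArg (fun X : A => obj s ⊗ X) obj_one) ≫ (ρ_ (obj s)).hom ≫
      eqToHom (congrArg obj (mul_one s).symm)
  psi_zero_left : ∀ t : Pi0 A, (psi 0 t).hom =
    eqToHom (congrArg (fun X : A => X ⊗ obj t) obj_zero) ≫ (zeroMul (obj t)).hom ≫
      eqToHom (obj_zero.symm.trans (congrArg obj (zero_mul t).symm))
  psi_zero_right : ∀ s : Pi0 A, (psi s 0).hom =
    eqToHom (congrArg (fun X : A => obj s ⊗ X) obj_zero) ≫ (mulZero (obj s)).hom ≫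
      eqToHom (obj_zero.symm.trans (congrArg obj (mul_zero s).symm))

namespace Stick

variable {A : Type u} [Category.{v} A] [MonoidalCategory A] [BraidedCategory A]
  [SymCatGroup A] [BraidedAnnCategory A] (S : Stick A)

/-- The identification of the representatives of two equal classes. -/
def cast {s t : Pi0 A} (h : s = t) : S.obj s ⟶ S.obj t := eqToHom (congrArg S.obj h)

/-- The element of `π₁` whose image under `γ` is the given automorphism of `X_s`. -/
noncomputable def ofEnd {s : Pi0 A} (f : S.obj s ⟶ S.obj s) : Pi1 A :=
  (gamma (S.obj s)).symm f

/-- The component `ξ`, transported from `a⁺`. -/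
noncomputable def xi (s t r : Pi0 A) : Pi1 A :=
  S.ofEnd ((S.phi s (t + r)).inv ≫ (𝟙 (S.obj s) ∔ₘ (S.phi t r).inv) ≫
    (addAssoc (S.obj s) (S.obj t) (S.obj r)).hom ≫ ((S.phi s t).hom ∔ₘ 𝟙 (S.obj r)) ≫
      (S.phi (s + t) r).hom ≫ S.cast (add_assoc s t r))

/-- The component `η`, transported from `c⁺`. -/
noncomputable def eta (s t : Pi0 A) : Pi1 A :=
  S.ofEnd ((S.phi s t).inv ≫ (addComm (S.obj s) (S.obj t)).hom ≫ (S.phi t s).hom ≫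
    S.cast (add_comm t s))

/-- The component `α`, transported from `a`. -/
noncomputable def alpha (s t r : Pi0 A) : Pi1 A :=
  S.ofEnd ((S.psi s (t * r)).inv ≫ (𝟙 (S.obj s) ⊗ₘ (S.psi t r).inv) ≫
    (α_ (S.obj s) (S.obj t) (S.obj r)).inv ≫ ((S.psi s t).hom ⊗ₘ 𝟙 (S.obj r)) ≫
      (S.psi (s * t) r).hom ≫ S.cast (mul_assoc s t r))

/-- The component `λ`, transported from the left distributivity constraint. -/
noncomputable def lam (s t r : Pi0 A) : Pi1 A :=
  S.ofEnd ((S.psi s (t + r)).inv ≫ (𝟙 (S.obj s) ⊗ₘ (S.phi t r).inv) ≫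
    (distL (S.obj s) (S.obj t) (S.obj r)).hom ≫ ((S.psi s t).hom ∔ₘ (S.psi s r).hom) ≫
      (S.phi (s * t) (s * r)).hom ≫ S.cast (mul_add s t r).symm)

/-- The component `ρ`, transported from the right distributivity constraint. -/
noncomputable def rho (s t r : Pi0 A) : Pi1 A :=
  S.ofEnd ((S.psi (s + t) r).inv ≫ ((S.phi s t).inv ⊗ₘ 𝟙 (S.obj r)) ≫
    (distR (S.obj s) (S.obj t) (S.obj r)).hom ≫ ((S.psi s r).hom ∔ₘ (S.psi t r).hom) ≫
      (S.phi (s * r) (t * r)).hom ≫ S.cast (add_mul s t r).symm)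

/-- The component `β`, transported from the braiding. -/
noncomputable def beta (s t : Pi0 A) : Pi1 A :=
  S.ofEnd ((S.psi s t).inv ≫ (β_ (S.obj s) (S.obj t)).hom ≫ (S.psi t s).hom ≫
    S.cast (mul_comm t s))

/-- The family `(h, β)` of the constraints that the stick induces on the reduced category. -/
noncomputable def structureMaps : AbCochain (Pi0 A) (Pi1 A) :=
  ((S.xi, S.eta, S.alpha, S.lam, S.rho), S.beta)

/-- The reduced braided Ann-category of `A` for the stick `S`: objects are the elements of `π₀`,
morphisms are the automorphisms `(s, u)` with `u` in `π₁`, and the constraints are the structure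
`(h, β)` induced by `S`. -/
abbrev Reduced (hS : S.structureMaps ∈ Z3ab (Pi0 A) (Pi1 A)) : Type u :=
  TypeRM (⟨S.structureMaps, hS⟩ : Z3ab (Pi0 A) (Pi1 A))

end Stick

end Sticks

end BrAnn

namespace BrAnn

/-! ## The automorphisms `γ_X(u)` -/

section UnitAction

variable {C : Type u} [Category.{v} C] [MonoidalCategory C]

/-! The group `M = π₁` acts on the whole category: `u ↦ γ_X(u)` is natural in `X`, takes sums of
elements to composites, and is compatible with both operations, `γ_X(u) ⊕ γ_Y(w) = γ_{X⊕Y}(u + w)`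
and `X ⊗ γ_Y(u) = γ_{XY}([X]·u)` (`gammaMap_naturality`, `addMap_gammaMap`, `whiskerLeft_gammaMap`;
the braiding gives the mirror image of the last).

Fix a stick and mark objects by an isomorphism to a representative, marking sums and products
through `φ` and `ψ`. Between marked objects of one class there is a canonical morphism, and every
morphism is the canonical one twisted by a unique element of `M`, its `value`. By the rules for `γ`,
`value` turns composition and `⊕` into addition and `⊗` into `(u, v) ↦ s·v + t·u`. These are the
operations of the reduced category, so computing with values is computing there.

The value of a constraint depends only on the classes of its arguments, by naturality, and equals
the corresponding component of the structure `(h, β)`. Hence taking values in a coherence diagram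
yields a cocycle identity. Unit constraints have value `0` because a stick uses them as `φ` and `ψ`
at units, and `ψ_{s,0} = L̂`, `ψ_{0,t} = R̂` give `λ(s,0,0) = 0` and `ρ(0,0,t) = 0`. The remaining
vanishing conditions follow from the triangle axioms, the compatibility of the distributivity
constraints with `1`, and the cocycle identities.

For two sticks, mark the representatives of the second in the first by isomorphisms `θ_s`, and let
`μ`, `ν` be the values of `φ'`, `ψ'`. Expanding the definition of `(h', β')` in values gives `(h, β)
- (h', β') = ∂(μ, ν)` (`structureMaps_sub_structureMaps`). If `θ` is the identification at `0` and
`1`, then `(μ, ν)` is normalized, so the cohomology classes agree. The same equation says that the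
identity functor with comparisons `μ` and `ν` is a braided Ann-functor (`coboundaryFunctor`); the
pair `(-μ, -ν)` gives its inverse. -/

theorem unitAction_naturality (u : 𝟙_ C ⟶ 𝟙_ C) {X Y : C} (f : X ⟶ Y) :
    ((λ_ X).inv ≫ u ▷ X ≫ (λ_ X).hom) ≫ f = f ≫ (λ_ Y).inv ≫ u ▷ Y ≫ (λ_ Y).hom := by
  simp only [Category.assoc]
  rw [← leftUnitor_naturality, leftUnitor_inv_naturality_assoc, whisker_exchange_assoc]

theorem unitAction_whiskerRight (u : 𝟙_ C ⟶ 𝟙_ C) (X Y : C) :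
    ((λ_ X).inv ≫ u ▷ X ≫ (λ_ X).hom) ▷ Y =
      (λ_ (X ⊗ Y)).inv ≫ u ▷ (X ⊗ Y) ≫ (λ_ (X ⊗ Y)).hom := by
  simp

/-- The action of the unit is visibly compatible with whiskering on the right. The braiding
exchanges the two whiskerings, and naturality lets the action pass through it. -/
theorem unitAction_whiskerLeft [BraidedCategory C] (u : 𝟙_ C ⟶ 𝟙_ C) (X Y : C) :
    X ◁ ((λ_ Y).inv ≫ u ▷ Y ≫ (λ_ Y).hom) =
      (λ_ (X ⊗ Y)).inv ≫ u ▷ (X ⊗ Y) ≫ (λ_ (X ⊗ Y)).hom := by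
  rw [← cancel_mono (β_ X Y).hom, unitAction_naturality, BraidedCategory.braiding_naturality_right,
    unitAction_whiskerRight]

theorem unitAction_tensorHom [BraidedCategory C] (u w : 𝟙_ C ⟶ 𝟙_ C) (X Y : C) :
    ((λ_ X).inv ≫ u ▷ X ≫ (λ_ X).hom) ⊗ₘ ((λ_ Y).inv ≫ w ▷ Y ≫ (λ_ Y).hom) =
      (λ_ (X ⊗ Y)).inv ≫ (u ≫ w) ▷ (X ⊗ Y) ≫ (λ_ (X ⊗ Y)).hom := by
  rw [MonoidalCategory.tensorHom_def, unitAction_whiskerRight, unitAction_whiskerLeft]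
  simp

end UnitAction

section Gamma

variable {C : Type u} [Category.{v} C] [SymCatGroup C]

theorem gammaMap_eq (X : C) (u : Pi1 C) :
    gammaMap X u = (zeroAdd X).inv ≫
      (SymCatGroup.plus (C := C)).whiskerRight (Pi1.aut u).hom X ≫ (zeroAdd X).hom := by
  unfold gammaMap addMap
  rw [@MonoidalCategory.tensorHom_id C _ SymCatGroup.plus]

/-- This makes `γ(u)` an automorphism of the identity functor, so that twists can be moved along any
morphism and collected. -/
theorem gammaMap_naturality (u : Pi1 C) {X Y : C} (f : X ⟶ Y) :
    gammaMap X u ≫ f = f ≫ gammaMap Y u := by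
  rw [gammaMap_eq, gammaMap_eq]
  exact @unitAction_naturality C _ SymCatGroup.plus _ _ _ f

theorem gammaMap_zero (X : C) : gammaMap X (0 : Pi1 C) = 𝟙 X := by
  rw [gammaMap_eq, Pi1.aut_zero, @MonoidalCategory.id_whiskerRight C _ SymCatGroup.plus]
  simp

theorem gammaMap_add (X : C) (u w : Pi1 C) :
    gammaMap X (u + w) = gammaMap X u ≫ gammaMap X w := by
  -- Multiplication in `Aut` reverses diagrammatic composition; swapping the summands compensates
  -- for it.
  rw [_root_.add_comm, gammaMap_eq, gammaMap_eq, gammaMap_eq, Pi1.aut_add,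
    @MonoidalCategory.comp_whiskerRight C _ SymCatGroup.plus]
  simp

theorem addMap_gammaMap (X Y : C) (u w : Pi1 C) :
    gammaMap X u ∔ₘ gammaMap Y w = gammaMap (X ∔ Y) (u + w) := by
  rw [_root_.add_comm, gammaMap_eq, gammaMap_eq, gammaMap_eq, Pi1.aut_add]
  exact @unitAction_tensorHom C _ SymCatGroup.plus
    SymCatGroup.plusSymm.toBraidedCategory _ _ X Y

/-- The left and right unit constraints agree at `0`, and conjugating `u ⊕ id_0` by the right one
returns `u`. -/
theorem gammaMap_unit (u : Pi1 C) : gammaMap (zero C) u = (Pi1.aut u).hom := by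
  rw [gammaMap_eq]
  have h := @MonoidalCategory.whiskerRight_id C _ SymCatGroup.plus _ _ (Pi1.aut u).hom
  have h1 := @unitors_equal C _ SymCatGroup.plus
  have h2 := @unitors_inv_equal C _ SymCatGroup.plus
  rw [h, zeroAdd, h1, h2]
  simp

variable [MonoidalCategory C]

/-- Since `γ_{X⊗Z}` is bijective, `X ⊗ γ_Z(u)` is `γ(w Z)` for some `w Z`, and the point is that `w`
is constant. On `Z ⊕ W` the twist by `u` may be placed on either summand, so naturality of the left
distributivity constraint gives `w (Z ⊕ W) = w Z` and `w (Z ⊕ W) = w W`. At the zero object, `w` is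
the module action by definition. -/
theorem whiskerLeft_gammaMap [AnnCategory C] (X Y : C) (u : Pi1 C) :
    X ◁ gammaMap Y u = gammaMap (X ⊗ Y) (act X u) := by
  have id_add (Z W : C) : (𝟙 Z ∔ₘ 𝟙 W) = 𝟙 (Z ∔ W) :=
    @MonoidalCategory.id_tensorHom_id C _ SymCatGroup.plus Z W
  have ex (Z : C) : ∃ w, gammaMap (X ⊗ Z) w = X ◁ gammaMap Z u :=
    (gammaMap_bijective (X ⊗ Z)).2 _
  choose w hw using ex
  have left (Z W : C) : w (Z ∔ W) = w Z := by
    apply (gammaMap_bijective (X ⊗ (Z ∔ W))).1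
    have h := AnnCategory.distL_natural (𝟙 X) (gammaMap Z u) (𝟙 W)
    -- The identity of `W` is written as `γ_W(0)`, so that `γ_Z(u) ⊕ id_W` becomes `γ_{Z⊕W}(u)`; the
    -- same is done after distributing.
    rw [← gammaMap_zero W, addMap_gammaMap, add_zero, gammaMap_zero, id_tensorHom, id_tensorHom,
      id_tensorHom, ← hw, ← hw, whiskerLeft_id, ← gammaMap_zero (X ⊗ W), addMap_gammaMap,
      add_zero, ← gammaMap_naturality] at h
    exact (cancel_mono _).1 h
  have right (Z W : C) : w (Z ∔ W) = w W := by
    apply (gammaMap_bijective (X ⊗ (Z ∔ W))).1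
    have h := AnnCategory.distL_natural (𝟙 X) (𝟙 Z) (gammaMap W u)
    rw [← gammaMap_zero Z, addMap_gammaMap, zero_add, gammaMap_zero, id_tensorHom, id_tensorHom,
      id_tensorHom, ← hw, ← hw, whiskerLeft_id, ← gammaMap_zero (X ⊗ Z), addMap_gammaMap,
      zero_add, ← gammaMap_naturality] at h
    exact (cancel_mono _).1 h
  -- The objects `Y` and `0` are compared through `Y ⊕ 0`.
  rw [← hw, ← left Y (zero C), right]
  congr 1
  apply Pi1.ext
  rw [act, actBy_hom, ← gammaMap_unit u, ← hw, gammaMap_naturality, Iso.inv_hom_id_assoc,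
    gammaMap_unit]

/-- Conjugation by the braiding reduces this to left whiskering. This is why a single action of `R`
on `M` serves for both sides. -/
theorem whiskerRight_gammaMap [BraidedCategory C] [BraidedAnnCategory C] (X Y : C) (u : Pi1 C) :
    gammaMap X u ▷ Y = gammaMap (X ⊗ Y) (act Y u) := by
  rw [← cancel_mono (β_ X Y).hom, gammaMap_naturality, BraidedCategory.braiding_naturality_left,
    whiskerLeft_gammaMap]

end Gamma

/-! ## Values of morphisms between marked objects -/

section MarkedObjects

variable {A : Type u} [Category.{v} A] [MonoidalCategory A] [BraidedCategory A]
  [SymCatGroup A] [BraidedAnnCategory A]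

/-- An object with a chosen isomorphism to a representative in the stick. -/
structure Marked (S : Stick A) where
  /-- the underlying object -/
  pt : A
  /-- the isomorphism class -/
  el : Pi0 A
  /-- the chosen isomorphism -/
  iso : pt ≅ S.obj el

namespace Marked

variable {S : Stick A}

/-- Morphisms ignore the markings. The class is part of the data, so composite marked objects carry
literally the class `P.el + Q.el` or `P.el * Q.el`, and the markings only enter through the value of
a morphism. -/
instance : Category.{v} (Marked S) where
  Hom P Q := P.pt ⟶ Q.pt
  id P := 𝟙 P.pt
  comp f g := CategoryStruct.comp (obj := A) f g
  id_comp f := Category.id_comp (obj := A) f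
  comp_id f := Category.comp_id (obj := A) f
  assoc f g h := Category.assoc (obj := A) f g h

/-- A morphism of underlying objects as a morphism of marked objects. -/
def homMk {P Q : Marked S} (f : P.pt ⟶ Q.pt) : P ⟶ Q := f

/-- An isomorphism of underlying objects as an isomorphism of marked objects. -/
def isoMk {P Q : Marked S} (f : P.pt ≅ Q.pt) : P ≅ Q where
  hom := f.hom
  inv := f.inv
  hom_inv_id := f.hom_inv_id
  inv_hom_id := f.inv_hom_id

theorem el_eq {P Q : Marked S} (f : P.pt ⟶ Q.pt) : P.el = Q.el := by
  rw [← S.mk_obj P.el, ← S.mk_obj Q.el]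
  exact Pi0.mk_eq (P.iso.symm ≪≫ asIso f ≪≫ Q.iso)

/-- The canonical morphism between marked objects of the same class. -/
def can (P Q : Marked S) (h : P.el = Q.el) : P.pt ⟶ Q.pt :=
  P.iso.hom ≫ S.cast h ≫ Q.iso.inv

theorem can_self (P : Marked S) : can P P rfl = 𝟙 P.pt := by
  simp [can, Stick.cast]

theorem can_comp (P Q T : Marked S) (h : P.el = Q.el) (h' : Q.el = T.el) :
    can P Q h ≫ can Q T h' = can P T (h.trans h') := by
  simp [can, Stick.cast]

/-- The element `u` of `π₁` such that `f` is the canonical morphism composed with `γ(u)`. -/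
noncomputable def value {P Q : Marked S} (f : P ⟶ Q) : Pi1 A :=
  (gamma P.pt).symm (CategoryStruct.comp (obj := A) f (can Q P (el_eq f).symm))

/-- The working form of the definition: `value f` is the unique twist in the factorization of `f`
through the canonical morphism. -/
theorem value_eq_iff {P Q : Marked S} (f : P ⟶ Q) (h : P.el = Q.el) (u : Pi1 A) :
    value f = u ↔ f = homMk (gammaMap P.pt u ≫ can P Q h) := by
  unfold value
  rw [Equiv.symm_apply_eq]
  change CategoryStruct.comp (obj := A) f (can Q P _) = gammaMap P.pt u ↔ _
  constructor
  · intro hf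
    rw [homMk, ← hf, Category.assoc, can_comp, can_self]
    exact (Category.comp_id (obj := A) f).symm
  · intro hf
    rw [hf, homMk, Category.assoc, can_comp, can_self, Category.comp_id]

theorem eq_gammaMap_can {P Q : Marked S} (f : P ⟶ Q) :
    f = homMk (gammaMap P.pt (value f) ≫ can P Q (el_eq f)) := (value_eq_iff f _ _).1 rfl

theorem value_can {P Q : Marked S} (h : P.el = Q.el) : value (homMk (can P Q h)) = 0 := by
  rw [value_eq_iff _ h, gammaMap_zero, Category.id_comp]

theorem value_eq_zero {P Q : Marked S} {f : P.pt ⟶ Q.pt} (h : P.el = Q.el) (hf : f = can P Q h) :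
    value (homMk f : P ⟶ Q) = 0 := by
  rw [hf, value_can]

@[simp] theorem value_id (P : Marked S) : value (𝟙 P) = 0 := by
  rw [value_eq_iff _ rfl, gammaMap_zero, can_self, Category.id_comp]
  rfl

-- By naturality of `γ`, the twist of `g` slides past the canonical part of `f`; then canonical
-- parts compose to a canonical morphism and twists add.
@[simp] theorem value_comp {P Q T : Marked S} (f : P ⟶ Q) (g : Q ⟶ T) :
    value (f ≫ g) = value f + value g := by
  rw [value_eq_iff _ ((el_eq f).trans (el_eq g))]
  conv_lhs => rw [eq_gammaMap_can f, eq_gammaMap_can g]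
  change (gammaMap _ _ ≫ can P Q _) ≫ gammaMap _ _ ≫ can Q T _ = _
  rw [Category.assoc, ← Category.assoc (can P Q _), ← gammaMap_naturality, Category.assoc,
    can_comp, ← Category.assoc, ← gammaMap_add]
  rfl

@[simp] theorem value_inv {P Q : Marked S} (e : P ≅ Q) : value e.inv = - value e.hom := by
  have h : value (e.hom ≫ e.inv) = 0 := by rw [e.hom_inv_id, value_id]
  rw [value_comp] at h
  exact (neg_eq_of_add_eq_zero_right h).symm

theorem value_end {P : Marked S} (f : P.pt ⟶ P.pt) :
    (gamma P.pt).symm f = value (homMk f : P ⟶ P) := by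
  rw [eq_comm, value_eq_iff _ rfl, can_self, Category.comp_id]
  change f = gamma P.pt _
  simp

/-- The sum of marked objects. -/
noncomputable abbrev sum (P Q : Marked S) : Marked S where
  pt := P.pt ∔ Q.pt
  el := P.el + Q.el
  iso := addIso P.iso Q.iso ≪≫ S.phi P.el Q.el

/-- The product of marked objects. -/
noncomputable abbrev prod (P Q : Marked S) : Marked S where
  pt := P.pt ⊗ Q.pt
  el := P.el * Q.el
  iso := (P.iso ⊗ᵢ Q.iso) ≪≫ S.psi P.el Q.el

theorem addMap_comp {X Y Z X' Y' Z' : A} (f : X ⟶ Y) (g : Y ⟶ Z) (f' : X' ⟶ Y') (g' : Y' ⟶ Z') :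
    (f ≫ g) ∔ₘ (f' ≫ g') = (f ∔ₘ f') ≫ (g ∔ₘ g') :=
  (@MonoidalCategory.tensorHom_comp_tensorHom A _ SymCatGroup.plus _ _ _ _ _ _ f f' g g').symm

theorem addMap_id (X Y : A) : (𝟙 X ∔ₘ 𝟙 Y) = 𝟙 (X ∔ Y) :=
  @MonoidalCategory.id_tensorHom_id A _ SymCatGroup.plus X Y

/-- Once the equal classes are identified, the markings of both sums pass through the same `φ`,
which cancels against its inverse. The product case is the same with `ψ`. -/
theorem addMap_can {P Q P' Q' : Marked S} (h : P.el = Q.el) (h' : P'.el = Q'.el) :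
    can P Q h ∔ₘ can P' Q' h' = can (P.sum P') (Q.sum Q') (congrArg₂ (· + ·) h h') := by
  obtain ⟨X, s, i⟩ := P
  obtain ⟨X', s', i'⟩ := P'
  obtain ⟨Y, t, j⟩ := Q
  obtain ⟨Y', t', j'⟩ := Q'
  dsimp only at h h'
  subst h h'
  simp only [can, addMap_comp, Stick.cast, eqToHom_refl, Category.id_comp, Iso.trans_hom,
    Iso.trans_inv, Category.assoc, Iso.hom_inv_id_assoc]
  rfl

theorem tensorHom_can {P Q P' Q' : Marked S} (h : P.el = Q.el) (h' : P'.el = Q'.el) :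
    can P Q h ⊗ₘ can P' Q' h' = can (P.prod P') (Q.prod Q') (congrArg₂ (· * ·) h h') := by
  obtain ⟨X, s, i⟩ := P
  obtain ⟨X', s', i'⟩ := P'
  obtain ⟨Y, t, j⟩ := Q
  obtain ⟨Y', t', j'⟩ := Q'
  dsimp only at h h'
  subst h h'
  simp only [can, ← tensorHom_comp_tensorHom, Stick.cast, eqToHom_refl, Category.id_comp,
    Iso.trans_hom, Iso.trans_inv, Category.assoc, Iso.hom_inv_id_assoc]
  rfl

/-- The sum of morphisms of marked objects. -/
def sumMap {P Q P' Q' : Marked S} (f : P ⟶ Q) (g : P' ⟶ Q') : P.sum P' ⟶ Q.sum Q' :=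
  addMap (C := A) f g

/-- The product of morphisms of marked objects. -/
def prodMap {P Q P' Q' : Marked S} (f : P ⟶ Q) (g : P' ⟶ Q') : P.prod P' ⟶ Q.prod Q' :=
  MonoidalCategoryStruct.tensorHom (C := A) f g

@[simp] theorem value_sumMap {P Q P' Q' : Marked S} (f : P ⟶ Q) (g : P' ⟶ Q') :
    value (sumMap f g) = value f + value g := by
  rw [value_eq_iff _ (congrArg₂ (· + ·) (el_eq f) (el_eq g))]
  conv_lhs => rw [eq_gammaMap_can f, eq_gammaMap_can g]
  simp only [sumMap, homMk]
  rw [addMap_comp, addMap_gammaMap, addMap_can]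

theorem act_pt (P : Marked S) (u : Pi1 A) : act P.pt u = P.el • u := by
  rw [← S.mk_obj P.el, ← Pi0.mk_eq P.iso]
  rfl

-- The canonical parts multiply to a canonical morphism, and each twist is multiplied by the class
-- of the other factor. This is the tensor product of morphisms in the reduced category.
@[simp] theorem value_prodMap {P Q P' Q' : Marked S} (f : P ⟶ Q) (g : P' ⟶ Q') :
    value (prodMap f g) = P.el • value g + P'.el • value f := by
  rw [value_eq_iff _ (congrArg₂ (· * ·) (el_eq f) (el_eq g))]
  conv_lhs => rw [eq_gammaMap_can f, eq_gammaMap_can g]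
  simp only [prodMap, homMk]
  rw [← tensorHom_comp_tensorHom, tensorHom_can, MonoidalCategory.tensorHom_def',
    whiskerLeft_gammaMap, whiskerRight_gammaMap, ← gammaMap_add, act_pt, act_pt]

end Marked

end MarkedObjects

end BrAnn
namespace BrAnn

/-! ### Constraints as morphisms of marked objects -/

section MarkedConstraints

variable {A : Type u} [Category.{v} A] [MonoidalCategory A] [BraidedCategory A]
  [SymCatGroup A] [BraidedAnnCategory A]

namespace Marked

variable {S : Stick A}

/-- The zero object with its canonical marking. -/
noncomputable abbrev zeroObj (S : Stick A) : Marked S := ⟨zero A, 0, eqToIso S.obj_zero.symm⟩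

/-- The unit object with its canonical marking. -/
noncomputable abbrev oneObj (S : Stick A) : Marked S := ⟨𝟙_ A, 1, eqToIso S.obj_one.symm⟩

/-- The associativity constraint of the sum. -/
noncomputable abbrev sumAssoc (P Q T : Marked S) : P.sum (Q.sum T) ≅ (P.sum Q).sum T :=
  isoMk (addAssoc P.pt Q.pt T.pt)

/-- The commutativity constraint of the sum. -/
noncomputable abbrev sumComm (P Q : Marked S) : P.sum Q ≅ Q.sum P := isoMk (addComm P.pt Q.pt)

/-- The left unit constraint of the sum. -/
noncomputable abbrev sumLeftUnitor (P : Marked S) : (zeroObj S).sum P ≅ P := isoMk (zeroAdd P.pt)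

/-- The right unit constraint of the sum. -/
noncomputable abbrev sumRightUnitor (P : Marked S) : P.sum (zeroObj S) ≅ P := isoMk (addZero P.pt)

/-- The associativity constraint of the product. -/
noncomputable abbrev prodAssoc (P Q T : Marked S) : P.prod (Q.prod T) ≅ (P.prod Q).prod T :=
  isoMk (α_ P.pt Q.pt T.pt).symm

/-- The braiding of the product. -/
noncomputable abbrev prodBraid (P Q : Marked S) : P.prod Q ≅ Q.prod P := isoMk (β_ P.pt Q.pt)

/-- The left unit constraint of the product. -/
noncomputable abbrev prodLeftUnitor (P : Marked S) : (oneObj S).prod P ≅ P := isoMk (λ_ P.pt)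

/-- The right unit constraint of the product. -/
noncomputable abbrev prodRightUnitor (P : Marked S) : P.prod (oneObj S) ≅ P := isoMk (ρ_ P.pt)

/-- The left distributivity constraint. -/
noncomputable abbrev prodSum (P Q T : Marked S) : P.prod (Q.sum T) ≅ (P.prod Q).sum (P.prod T) :=
  isoMk (AnnCategory.distL P.pt Q.pt T.pt)

/-- The right distributivity constraint. -/
noncomputable abbrev sumProd (P Q T : Marked S) : (P.sum Q).prod T ≅ (P.prod T).sum (Q.prod T) :=
  isoMk (AnnCategory.distR P.pt Q.pt T.pt)

/-- The isomorphism `P ⊗ 0 ⟶ 0`. -/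
noncomputable abbrev prodZero (P : Marked S) : P.prod (zeroObj S) ≅ zeroObj S :=
  isoMk (mulZero P.pt)

/-- The isomorphism `0 ⊗ P ⟶ 0`. -/
noncomputable abbrev zeroProd (P : Marked S) : (zeroObj S).prod P ≅ zeroObj S :=
  isoMk (zeroMul P.pt)

/-! ### Naturality: values of constraints depend only on classes -/

section Congruence

variable {P P' Q Q' T T' : Marked S} (hP : P.el = P'.el) (hQ : Q.el = Q'.el) (hT : T.el = T'.el)
include hP

/-- Canonical morphisms have value `0`, and so do their sums and products. The naturality square of
a constraint with respect to them therefore equates its values at both corners. Every lemma of this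
section is an instance of this argument. -/
theorem value_sumLeftUnitor_congr :
    value (sumLeftUnitor P).hom = value (sumLeftUnitor P').hom := by
  have h : sumMap (𝟙 _) (homMk (can P P' hP)) ≫ (sumLeftUnitor P').hom =
      (sumLeftUnitor P).hom ≫ homMk (can P P' hP) := by
    have h := @leftUnitor_naturality A _ SymCatGroup.plus _ _ (can P P' hP)
    rw [← @id_tensorHom A _ SymCatGroup.plus] at h
    exact h
  simpa [value_can] using congrArg value h.symm

theorem value_sumRightUnitor_congr :
    value (sumRightUnitor P).hom = value (sumRightUnitor P').hom := by
  have h : sumMap (homMk (can P P' hP)) (𝟙 _) ≫ (sumRightUnitor P').hom =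
      (sumRightUnitor P).hom ≫ homMk (can P P' hP) := by
    have h := @rightUnitor_naturality A _ SymCatGroup.plus _ _ (can P P' hP)
    rw [← @tensorHom_id A _ SymCatGroup.plus] at h
    exact h
  simpa [value_can] using congrArg value h.symm

theorem value_prodLeftUnitor_congr :
    value (prodLeftUnitor P).hom = value (prodLeftUnitor P').hom := by
  have h : prodMap (𝟙 _) (homMk (can P P' hP)) ≫ (prodLeftUnitor P').hom =
      (prodLeftUnitor P).hom ≫ homMk (can P P' hP) := by
    have h := leftUnitor_naturality (can P P' hP)
    rw [← id_tensorHom] at h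
    exact h
  simpa [value_can] using congrArg value h.symm

theorem value_prodRightUnitor_congr :
    value (prodRightUnitor P).hom = value (prodRightUnitor P').hom := by
  have h : prodMap (homMk (can P P' hP)) (𝟙 _) ≫ (prodRightUnitor P').hom =
      (prodRightUnitor P).hom ≫ homMk (can P P' hP) := by
    have h := rightUnitor_naturality (can P P' hP)
    rw [← tensorHom_id] at h
    exact h
  simpa [value_can] using congrArg value h.symm

include hQ

theorem value_sumComm_congr : value (sumComm P Q).hom = value (sumComm P' Q').hom := by
  have h : sumMap (homMk (can P P' hP)) (homMk (can Q Q' hQ)) ≫ (sumComm P' Q').hom =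
      (sumComm P Q).hom ≫ sumMap (homMk (can Q Q' hQ)) (homMk (can P P' hP)) :=
    @BraidedCategory.braiding_naturality A _ SymCatGroup.plus
      SymCatGroup.plusSymm.toBraidedCategory _ _ _ _ (can P P' hP) (can Q Q' hQ)
  simpa [value_can] using congrArg value h.symm

theorem value_prodBraid_congr : value (prodBraid P Q).hom = value (prodBraid P' Q').hom := by
  have h : prodMap (homMk (can P P' hP)) (homMk (can Q Q' hQ)) ≫ (prodBraid P' Q').hom =
      (prodBraid P Q).hom ≫ prodMap (homMk (can Q Q' hQ)) (homMk (can P P' hP)) :=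
    BraidedCategory.braiding_naturality (can P P' hP) (can Q Q' hQ)
  simpa [value_can] using congrArg value h.symm

include hT

theorem value_sumAssoc_congr : value (sumAssoc P Q T).hom = value (sumAssoc P' Q' T').hom := by
  have h : sumMap (homMk (can P P' hP)) (sumMap (homMk (can Q Q' hQ)) (homMk (can T T' hT))) ≫
      (sumAssoc P' Q' T').hom = (sumAssoc P Q T).hom ≫
        sumMap (sumMap (homMk (can P P' hP)) (homMk (can Q Q' hQ))) (homMk (can T T' hT)) :=
    @associator_inv_naturality A _ SymCatGroup.plus _ _ _ _ _ _
      (can P P' hP) (can Q Q' hQ) (can T T' hT)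
  simpa [value_can] using congrArg value h.symm

theorem value_prodAssoc_congr : value (prodAssoc P Q T).hom = value (prodAssoc P' Q' T').hom := by
  have h : prodMap (homMk (can P P' hP)) (prodMap (homMk (can Q Q' hQ)) (homMk (can T T' hT))) ≫
      (prodAssoc P' Q' T').hom = (prodAssoc P Q T).hom ≫
        prodMap (prodMap (homMk (can P P' hP)) (homMk (can Q Q' hQ))) (homMk (can T T' hT)) :=
    associator_inv_naturality (can P P' hP) (can Q Q' hQ) (can T T' hT)
  simpa [value_can] using congrArg value h.symm

theorem value_prodSum_congr : value (prodSum P Q T).hom = value (prodSum P' Q' T').hom := by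
  have h : prodMap (homMk (can P P' hP)) (sumMap (homMk (can Q Q' hQ)) (homMk (can T T' hT))) ≫
      (prodSum P' Q' T').hom = (prodSum P Q T).hom ≫
        sumMap (prodMap (homMk (can P P' hP)) (homMk (can Q Q' hQ)))
          (prodMap (homMk (can P P' hP)) (homMk (can T T' hT))) :=
    AnnCategory.distL_natural (can P P' hP) (can Q Q' hQ) (can T T' hT)
  simpa [value_can] using congrArg value h.symm

theorem value_sumProd_congr : value (sumProd P Q T).hom = value (sumProd P' Q' T').hom := by
  have h : prodMap (sumMap (homMk (can P P' hP)) (homMk (can Q Q' hQ))) (homMk (can T T' hT)) ≫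
      (sumProd P' Q' T').hom = (sumProd P Q T).hom ≫
        sumMap (prodMap (homMk (can P P' hP)) (homMk (can T T' hT)))
          (prodMap (homMk (can Q Q' hQ)) (homMk (can T T' hT))) :=
    AnnCategory.distR_natural (can P P' hP) (can Q Q' hQ) (can T T' hT)
  simpa [value_can] using congrArg value h.symm

end Congruence

end Marked

end MarkedConstraints

/-! ## The constraints of one stick in terms of the marking by another -/

namespace Stick

open Marked

variable {A : Type u} [Category.{v} A] [MonoidalCategory A] [BraidedCategory A]
  [SymCatGroup A] [BraidedAnnCategory A] (T : Stick A) {S : Stick A}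
  (θ : ∀ s, T.obj s ≅ S.obj s)

/-- The representative of `s` in the stick `T`, marked in the stick `S`. -/
noncomputable abbrev marked (s : Pi0 A) : Marked S := ⟨T.obj s, s, θ s⟩

/-- The isomorphism `phi` of the stick `T` as an isomorphism of marked objects. -/
noncomputable abbrev markedPhi (s t : Pi0 A) : (T.marked θ s).sum (T.marked θ t) ≅ T.marked θ (s + t) :=
  isoMk (T.phi s t)

/-- The isomorphism `psi` of the stick `T` as an isomorphism of marked objects. -/
noncomputable abbrev markedPsi (s t : Pi0 A) : (T.marked θ s).prod (T.marked θ t) ≅ T.marked θ (s * t) :=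
  isoMk (T.psi s t)

/-- The identification of the representatives of two equal classes. -/
noncomputable abbrev markedCast {s t : Pi0 A} (h : s = t) : T.marked θ s ⟶ T.marked θ t := homMk (T.cast h)

/-- The comparison `μ` of the isomorphisms `phi` of two sticks. -/
noncomputable def mu (s t : Pi0 A) : Pi1 A := value (T.markedPhi θ s t).hom

/-- The comparison `ν` of the isomorphisms `psi` of two sticks. -/
noncomputable def nu (s t : Pi0 A) : Pi1 A := value (T.markedPsi θ s t).hom

theorem value_markedPhi (s t : Pi0 A) : value (T.markedPhi θ s t).hom = T.mu θ s t := rfl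

theorem value_markedPsi (s t : Pi0 A) : value (T.markedPsi θ s t).hom = T.nu θ s t := rfl

theorem value_markedCast {s t : Pi0 A} (h : s = t) : value (T.markedCast θ h) = 0 := by
  subst h
  exact value_id _

/-- For an endomorphism the canonical part is the identity whatever the marking, so the
identification by `γ` used in the structure of `T` can be computed with markings in another stick
`S`. -/
theorem ofEnd_eq {s : Pi0 A} (f : T.obj s ⟶ T.obj s) :
    T.ofEnd f = value (homMk f : T.marked θ s ⟶ T.marked θ s) := value_end (P := T.marked θ s) f

/-- The transport defining `T.xi` is a composite of morphisms of marked objects, so its value is the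
sum of theirs: `φ` contributes `μ` with a sign, the cast contributes nothing, and the constraint
itself is left to be measured in `S`. The analogous formulas for the other components also involve
`ν` and scalars coming from products with identities. -/
theorem xi_eq_value (s t r : Pi0 A) : T.xi s t r =
    value (sumAssoc (T.marked θ s) (T.marked θ t) (T.marked θ r)).hom +
      T.mu θ s t + T.mu θ (s + t) r - T.mu θ s (t + r) - T.mu θ t r := by
  have h : T.xi s t r = value ((T.markedPhi θ s (t + r)).inv ≫
      sumMap (𝟙 _) (T.markedPhi θ t r).inv ≫
      (sumAssoc (T.marked θ s) (T.marked θ t) (T.marked θ r)).hom ≫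
      sumMap (T.markedPhi θ s t).hom (𝟙 _) ≫ (T.markedPhi θ (s + t) r).hom ≫
      T.markedCast θ (add_assoc s t r)) := T.ofEnd_eq θ _
  rw [h]
  simp only [value_comp, value_inv, value_sumMap, value_id, value_markedPhi, value_markedCast]
  abel

theorem eta_eq_value (s t : Pi0 A) : T.eta s t =
    value (sumComm (T.marked θ s) (T.marked θ t)).hom + T.mu θ t s - T.mu θ s t := by
  have h : T.eta s t = value ((T.markedPhi θ s t).inv ≫
      (sumComm (T.marked θ s) (T.marked θ t)).hom ≫
      (T.markedPhi θ t s).hom ≫ T.markedCast θ (add_comm t s)) := T.ofEnd_eq θ _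
  rw [h]
  simp only [value_comp, value_inv, value_markedPhi, value_markedCast]
  abel

theorem alpha_eq_value (s t r : Pi0 A) : T.alpha s t r =
    value (prodAssoc (T.marked θ s) (T.marked θ t) (T.marked θ r)).hom +
      r • T.nu θ s t + T.nu θ (s * t) r - T.nu θ s (t * r) - s • T.nu θ t r := by
  have h : T.alpha s t r = value ((T.markedPsi θ s (t * r)).inv ≫
      prodMap (𝟙 _) (T.markedPsi θ t r).inv ≫
      (prodAssoc (T.marked θ s) (T.marked θ t) (T.marked θ r)).hom ≫
      prodMap (T.markedPsi θ s t).hom (𝟙 _) ≫ (T.markedPsi θ (s * t) r).hom ≫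
      T.markedCast θ (mul_assoc s t r)) := T.ofEnd_eq θ _
  rw [h]
  simp only [value_comp, value_inv, value_prodMap, value_id, value_markedPsi, value_markedCast]
  module

theorem lam_eq_value (s t r : Pi0 A) : T.lam s t r =
    value (prodSum (T.marked θ s) (T.marked θ t) (T.marked θ r)).hom +
      T.nu θ s t + T.nu θ s r + T.mu θ (s * t) (s * r) - T.nu θ s (t + r) - s • T.mu θ t r := by
  have h : T.lam s t r = value ((T.markedPsi θ s (t + r)).inv ≫
      prodMap (𝟙 _) (T.markedPhi θ t r).inv ≫
      (prodSum (T.marked θ s) (T.marked θ t) (T.marked θ r)).hom ≫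
      sumMap (T.markedPsi θ s t).hom (T.markedPsi θ s r).hom ≫
      (T.markedPhi θ (s * t) (s * r)).hom ≫
      T.markedCast θ (mul_add s t r).symm) := T.ofEnd_eq θ _
  rw [h]
  simp only [value_comp, value_inv, value_prodMap, value_sumMap, value_id, value_markedPsi, value_markedPhi,
    value_markedCast]
  module

theorem rho_eq_value (s t r : Pi0 A) : T.rho s t r =
    value (sumProd (T.marked θ s) (T.marked θ t) (T.marked θ r)).hom +
      T.nu θ s r + T.nu θ t r + T.mu θ (s * r) (t * r) - T.nu θ (s + t) r - r • T.mu θ s t := by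
  have h : T.rho s t r = value ((T.markedPsi θ (s + t) r).inv ≫
      prodMap (T.markedPhi θ s t).inv (𝟙 _) ≫
      (sumProd (T.marked θ s) (T.marked θ t) (T.marked θ r)).hom ≫
      sumMap (T.markedPsi θ s r).hom (T.markedPsi θ t r).hom ≫
      (T.markedPhi θ (s * r) (t * r)).hom ≫
      T.markedCast θ (add_mul s t r).symm) := T.ofEnd_eq θ _
  rw [h]
  simp only [value_comp, value_inv, value_prodMap, value_sumMap, value_id, value_markedPsi, value_markedPhi,
    value_markedCast]
  module

theorem beta_eq_value (s t : Pi0 A) : T.beta s t =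
    value (prodBraid (T.marked θ s) (T.marked θ t)).hom + T.nu θ t s - T.nu θ s t := by
  have h : T.beta s t = value ((T.markedPsi θ s t).inv ≫
      (prodBraid (T.marked θ s) (T.marked θ t)).hom ≫
      (T.markedPsi θ t s).hom ≫ T.markedCast θ (mul_comm t s)) := T.ofEnd_eq θ _
  rw [h]
  simp only [value_comp, value_inv, value_markedPsi, value_markedCast]
  abel

/-- The marking of the representatives of a stick by themselves. -/
noncomputable abbrev selfMark (S : Stick A) (s : Pi0 A) : S.obj s ≅ S.obj s := Iso.refl (S.obj s)

/-- When a stick marks its own representatives, the marking of `X_s ⊕ X_t` is `φ_{s,t}` itself,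
which makes `φ_{s,t}` canonical. -/
theorem mu_selfMark (s t : Pi0 A) : S.mu S.selfMark s t = 0 := by
  refine value_eq_zero rfl ?_
  change (S.phi s t).hom = (((𝟙 (S.obj s) ∔ₘ 𝟙 (S.obj t)) ≫ (S.phi s t).hom) ≫ S.cast rfl ≫ 𝟙 _)
  rw [addMap_id]
  simp [Stick.cast]

theorem nu_selfMark (s t : Pi0 A) : S.nu S.selfMark s t = 0 := by
  refine value_eq_zero rfl ?_
  change (S.psi s t).hom = (((𝟙 (S.obj s) ⊗ₘ 𝟙 (S.obj t)) ≫ (S.psi s t).hom) ≫ S.cast rfl ≫ 𝟙 _)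
  simp [Stick.cast]

end Stick

/-! ### Values of the constraints are the components of the structure -/

namespace Marked

variable {A : Type u} [Category.{v} A] [MonoidalCategory A] [BraidedCategory A]
  [SymCatGroup A] [BraidedAnnCategory A] {S : Stick A} (P Q T : Marked S)

/-- For the self-marking the corrections by `μ` and `ν` vanish, so `S.xi` is the value of the
constraint at the representatives; naturality carries this to arbitrary marked objects, in
particular to sums and products. -/
theorem value_sumAssoc : value (sumAssoc P Q T).hom = S.xi P.el Q.el T.el := by
  rw [S.xi_eq_value S.selfMark]
  simp only [Stick.mu_selfMark, add_zero, sub_zero]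
  exact value_sumAssoc_congr rfl rfl rfl

theorem value_sumComm : value (sumComm P Q).hom = S.eta P.el Q.el := by
  rw [S.eta_eq_value S.selfMark]
  simp only [Stick.mu_selfMark, add_zero, sub_zero]
  exact value_sumComm_congr rfl rfl

theorem value_prodAssoc : value (prodAssoc P Q T).hom = S.alpha P.el Q.el T.el := by
  rw [S.alpha_eq_value S.selfMark]
  simp only [Stick.nu_selfMark, add_zero, sub_zero, smul_zero]
  exact value_prodAssoc_congr rfl rfl rfl

theorem value_prodSum : value (prodSum P Q T).hom = S.lam P.el Q.el T.el := by
  rw [S.lam_eq_value S.selfMark]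
  simp only [Stick.nu_selfMark, Stick.mu_selfMark, add_zero, sub_zero, smul_zero]
  exact value_prodSum_congr rfl rfl rfl

theorem value_sumProd : value (sumProd P Q T).hom = S.rho P.el Q.el T.el := by
  rw [S.rho_eq_value S.selfMark]
  simp only [Stick.nu_selfMark, Stick.mu_selfMark, add_zero, sub_zero, smul_zero]
  exact value_sumProd_congr rfl rfl rfl

theorem value_prodBraid : value (prodBraid P Q).hom = S.beta P.el Q.el := by
  rw [S.beta_eq_value S.selfMark]
  simp only [Stick.nu_selfMark, add_zero, sub_zero]
  exact value_prodBraid_congr rfl rfl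

end Marked

/-! ## Normalization -/

section Normalization

variable {A : Type u} [Category.{v} A] [MonoidalCategory A] [BraidedCategory A]
  [SymCatGroup A] [BraidedAnnCategory A]

/-- The normalizations of a stick transport a whole sum or product along an equality of one factor;
splitting the transport into a factor and an identity makes its value computable. -/
theorem eqToHom_addMap_id {X Y : A} (h : X = Y) (Z : A) :
    eqToHom (congrArg (fun X : A => X ∔ Z) h) = eqToHom h ∔ₘ 𝟙 Z := by
  subst h
  exact (@id_tensorHom_id A _ SymCatGroup.plus X Z).symm

theorem id_addMap_eqToHom {X Y : A} (h : X = Y) (Z : A) :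
    eqToHom (congrArg (fun X : A => Z ∔ X) h) = 𝟙 Z ∔ₘ eqToHom h := by
  subst h
  exact (@id_tensorHom_id A _ SymCatGroup.plus Z X).symm

theorem eqToHom_tensorHom_id {X Y : A} (h : X = Y) (Z : A) :
    eqToHom (congrArg (fun X : A => X ⊗ Z) h) = eqToHom h ⊗ₘ 𝟙 Z := by
  subst h
  simp

theorem id_tensorHom_eqToHom {X Y : A} (h : X = Y) (Z : A) :
    eqToHom (congrArg (fun X : A => Z ⊗ X) h) = 𝟙 Z ⊗ₘ eqToHom h := by
  subst h
  simp

end Normalization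

namespace Stick

open Marked

variable {A : Type u} [Category.{v} A] [MonoidalCategory A] [BraidedCategory A]
  [SymCatGroup A] [BraidedAnnCategory A] (T : Stick A) {S : Stick A}

/-- A family of isomorphisms between the representatives of two sticks is normalized if it is the
identity at `0` and `1`. -/
structure IsNormalizedMark (θ : ∀ s, T.obj s ≅ S.obj s) : Prop where
  zero : θ 0 = eqToIso (T.obj_zero.trans S.obj_zero.symm)
  one : θ 1 = eqToIso (T.obj_one.trans S.obj_one.symm)

theorem isNormalizedMark_selfMark : S.IsNormalizedMark S.selfMark := ⟨rfl, rfl⟩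

theorem exists_isNormalizedMark (S T : Stick A) :
    ∃ θ : ∀ s, T.obj s ≅ S.obj s, T.IsNormalizedMark θ := by
  classical
  have ex (s : Pi0 A) : Nonempty (T.obj s ≅ S.obj s) :=
    Quotient.exact (s := isIsomorphicSetoid A) ((T.mk_obj s).trans (S.mk_obj s).symm)
  have h (s : Pi0 A) : ∃ i : T.obj s ≅ S.obj s,
      ∀ h : T.obj s = S.obj s, s = 0 ∨ s = 1 → i = eqToIso h := by
    -- The identification is used wherever the two representatives happen to coincide, rather than
    -- by testing `s = 0` and `s = 1`. This stays consistent when `0 = 1` in `π₀`.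
    by_cases hs : T.obj s = S.obj s
    · exact ⟨eqToIso hs, fun _ _ => rfl⟩
    · exact ⟨(ex s).some, fun h _ => absurd h hs⟩
  choose θ hθ using h
  exact ⟨θ, hθ 0 _ (Or.inl rfl), hθ 1 _ (Or.inr rfl)⟩

variable {T} {θ : ∀ s, T.obj s ≅ S.obj s} (hθ : T.IsNormalizedMark θ)
include hθ

/-- The marking of the representative of `0` is itself an identification of equal objects, so
passing to the zero object is canonical. This is where normalization of `θ` enters. -/
theorem IsNormalizedMark.value_toZero :
    value (homMk (eqToHom T.obj_zero) : T.marked θ 0 ⟶ zeroObj S) = 0 := by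
  refine value_eq_zero rfl ?_
  simp [can, Stick.cast, hθ.zero]

theorem IsNormalizedMark.value_ofZero {s : Pi0 A} (h : 0 = s) :
    value (homMk (eqToHom (T.obj_zero.symm.trans (congrArg T.obj h))) :
      zeroObj S ⟶ T.marked θ s) = 0 := by
  subst h
  refine value_eq_zero rfl ?_
  simp [can, Stick.cast, hθ.zero]

theorem IsNormalizedMark.value_toOne :
    value (homMk (eqToHom T.obj_one) : T.marked θ 1 ⟶ oneObj S) = 0 := by
  refine value_eq_zero rfl ?_
  simp [can, Stick.cast, hθ.one]

/-- A stick has `φ_{0,t} = g` up to identifications, and under a normalized marking these have value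
`0`. The other boundary values of `μ` and `ν` reduce in the same way to values of unit constraints
and of `L̂`, `R̂`. -/
theorem IsNormalizedMark.mu_zero_left' (t : Pi0 A) :
    T.mu θ 0 t = value (sumLeftUnitor (T.marked θ t)).hom := by
  have h : (T.markedPhi θ 0 t).hom = sumMap (homMk (eqToHom T.obj_zero)) (𝟙 _) ≫
      (sumLeftUnitor (T.marked θ t)).hom ≫ T.markedCast θ (zero_add t).symm := by
    have h := T.phi_zero_left t
    rw [eqToHom_addMap_id T.obj_zero] at h
    exact h
  unfold mu
  rw [h]
  simp only [value_comp, value_sumMap, value_id, hθ.value_toZero, value_markedCast, zero_add, add_zero]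

theorem IsNormalizedMark.mu_zero_right' (t : Pi0 A) :
    T.mu θ t 0 = value (sumRightUnitor (T.marked θ t)).hom := by
  have h : (T.markedPhi θ t 0).hom = sumMap (𝟙 _) (homMk (eqToHom T.obj_zero)) ≫
      (sumRightUnitor (T.marked θ t)).hom ≫ T.markedCast θ (add_zero t).symm := by
    have h := T.phi_zero_right t
    rw [id_addMap_eqToHom T.obj_zero] at h
    exact h
  unfold mu
  rw [h]
  simp only [value_comp, value_sumMap, value_id, hθ.value_toZero, value_markedCast, zero_add, add_zero]

theorem IsNormalizedMark.nu_one_left' (t : Pi0 A) :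
    T.nu θ 1 t = value (prodLeftUnitor (T.marked θ t)).hom := by
  have h : (T.markedPsi θ 1 t).hom = prodMap (homMk (eqToHom T.obj_one)) (𝟙 _) ≫
      (prodLeftUnitor (T.marked θ t)).hom ≫ T.markedCast θ (one_mul t).symm := by
    have h := T.psi_one_left t
    rw [eqToHom_tensorHom_id T.obj_one] at h
    exact h
  unfold nu
  rw [h]
  simp only [value_comp, value_prodMap, value_id, hθ.value_toOne, value_markedCast, zero_add, add_zero,
    smul_zero]

theorem IsNormalizedMark.nu_one_right' (t : Pi0 A) :
    T.nu θ t 1 = value (prodRightUnitor (T.marked θ t)).hom := by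
  have h : (T.markedPsi θ t 1).hom = prodMap (𝟙 _) (homMk (eqToHom T.obj_one)) ≫
      (prodRightUnitor (T.marked θ t)).hom ≫ T.markedCast θ (mul_one t).symm := by
    have h := T.psi_one_right t
    rw [id_tensorHom_eqToHom T.obj_one] at h
    exact h
  unfold nu
  rw [h]
  simp only [value_comp, value_prodMap, value_id, hθ.value_toOne, value_markedCast, zero_add, add_zero,
    smul_zero]

theorem IsNormalizedMark.nu_zero_left' (t : Pi0 A) :
    T.nu θ 0 t = value (zeroProd (T.marked θ t)).hom := by
  have h : (T.markedPsi θ 0 t).hom = prodMap (homMk (eqToHom T.obj_zero)) (𝟙 _) ≫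
      (zeroProd (T.marked θ t)).hom ≫
      (homMk (eqToHom (T.obj_zero.symm.trans (congrArg T.obj (zero_mul t).symm))) :
        zeroObj S ⟶ T.marked θ (0 * t)) := by
    have h := T.psi_zero_left t
    rw [eqToHom_tensorHom_id T.obj_zero] at h
    exact h
  unfold nu
  rw [h]
  simp only [value_comp, value_prodMap, value_id, hθ.value_toZero, hθ.value_ofZero (zero_mul t).symm, zero_add, add_zero,
    smul_zero]

theorem IsNormalizedMark.nu_zero_right' (t : Pi0 A) :
    T.nu θ t 0 = value (prodZero (T.marked θ t)).hom := by
  have h : (T.markedPsi θ t 0).hom = prodMap (𝟙 _) (homMk (eqToHom T.obj_zero)) ≫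
      (prodZero (T.marked θ t)).hom ≫
      (homMk (eqToHom (T.obj_zero.symm.trans (congrArg T.obj (mul_zero t).symm))) :
        zeroObj S ⟶ T.marked θ (t * 0)) := by
    have h := T.psi_zero_right t
    rw [id_tensorHom_eqToHom T.obj_zero] at h
    exact h
  unfold nu
  rw [h]
  simp only [value_comp, value_prodMap, value_id, hθ.value_toZero, hθ.value_ofZero (mul_zero t).symm, zero_add, add_zero,
    smul_zero]

end Stick

/-! ### Values of the unit constraints and of the zero isomorphisms -/

namespace Marked

variable {A : Type u} [Category.{v} A] [MonoidalCategory A] [BraidedCategory A]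
  [SymCatGroup A] [BraidedAnnCategory A] {S : Stick A} (P Q T : Marked S)

/-- For the self-marking, `μ(0, s)` is on the one hand `0` and on the other hand the value of the
unit constraint. -/
theorem value_sumLeftUnitor : value (sumLeftUnitor P).hom = 0 := by
  rw [← S.mu_selfMark 0 P.el, Stick.isNormalizedMark_selfMark.mu_zero_left']
  exact value_sumLeftUnitor_congr rfl

theorem value_sumRightUnitor : value (sumRightUnitor P).hom = 0 := by
  rw [← S.mu_selfMark P.el 0, Stick.isNormalizedMark_selfMark.mu_zero_right']
  exact value_sumRightUnitor_congr rfl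

theorem value_prodLeftUnitor : value (prodLeftUnitor P).hom = 0 := by
  rw [← S.nu_selfMark 1 P.el, Stick.isNormalizedMark_selfMark.nu_one_left']
  exact value_prodLeftUnitor_congr rfl

theorem value_prodRightUnitor : value (prodRightUnitor P).hom = 0 := by
  rw [← S.nu_selfMark P.el 1, Stick.isNormalizedMark_selfMark.nu_one_right']
  exact value_prodRightUnitor_congr rfl

/-- The equation characterizing `mulZero` contains, besides it, only unit constraints, of value `0`,
and one inverse distributivity constraint. -/
theorem value_prodZero_eq_neg_lam : value (prodZero P).hom = - S.lam P.el 0 0 := by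
  have h : sumMap (prodZero P).hom (𝟙 _) ≫ (sumLeftUnitor (P.prod (zeroObj S))).hom =
      (prodSum P (zeroObj S) (zeroObj S)).inv ≫
        prodMap (𝟙 _) (sumLeftUnitor (zeroObj S)).hom := by
    have h := toZero_spec ((AnnCategory.distL P.pt (zero A) (zero A)).symm ≪≫
      whiskerLeftIso P.pt (zeroAdd (zero A)))
    rw [Iso.trans_hom, whiskerLeftIso_hom, ← id_tensorHom] at h
    exact h
  simpa [value_sumLeftUnitor, value_prodSum] using congrArg value h

theorem value_zeroProd_eq_neg_rho : value (zeroProd P).hom = - S.rho 0 0 P.el := by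
  have h : sumMap (zeroProd P).hom (𝟙 _) ≫ (sumLeftUnitor ((zeroObj S).prod P)).hom =
      (sumProd (zeroObj S) (zeroObj S) P).inv ≫
        prodMap (sumLeftUnitor (zeroObj S)).hom (𝟙 _) := by
    have h := toZero_spec ((AnnCategory.distR (zero A) (zero A) P.pt).symm ≪≫
      whiskerRightIso (zeroAdd (zero A)) P.pt)
    rw [Iso.trans_hom, whiskerRightIso_hom, ← tensorHom_id] at h
    exact h
  simpa [value_sumLeftUnitor, value_sumProd] using congrArg value h

end Marked

/-! ### The comparison of two sticks is normalized and bounds the difference of their structures -/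

namespace Stick

open Marked

variable {A : Type u} [Category.{v} A] [MonoidalCategory A] [BraidedCategory A]
  [SymCatGroup A] [BraidedAnnCategory A] {S : Stick A}

/-- The condition `ψ_{s,0} = L̂` makes `L̂` canonical, while its value is `-λ(s,0,0)`. The vanishing
of `λ` at zero arguments will be derived from this and its analogue for `ρ`. -/
theorem lam_zero_zero (s : Pi0 A) : S.lam s 0 0 = 0 := by
  have h := isNormalizedMark_selfMark.nu_zero_right' (S := S) s
  rw [nu_selfMark, value_prodZero_eq_neg_lam] at h
  exact neg_eq_zero.1 h.symm

theorem rho_zero_zero (s : Pi0 A) : S.rho 0 0 s = 0 := by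
  have h := isNormalizedMark_selfMark.nu_zero_left' (S := S) s
  rw [nu_selfMark, value_zeroProd_eq_neg_rho] at h
  exact neg_eq_zero.1 h.symm

theorem IsNormalizedMark.isNormalized {T : Stick A} {θ : ∀ s, T.obj s ≅ S.obj s}
    (hθ : T.IsNormalizedMark θ) : IsNormalized (T.mu θ, T.nu θ) where
  mu_norm s := by
    simp only [hθ.mu_zero_left', hθ.mu_zero_right', value_sumLeftUnitor, value_sumRightUnitor,
      and_self]
  nu_norm s := by
    simp only [hθ.nu_zero_left', hθ.nu_zero_right', hθ.nu_one_left', hθ.nu_one_right',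
      value_zeroProd_eq_neg_rho, value_prodZero_eq_neg_lam, value_prodLeftUnitor, value_prodRightUnitor,
      lam_zero_zero, rho_zero_zero, neg_zero, and_self]

/-- Each component of the structure of `T` is that of `S` plus terms in `μ` and `ν`, which are minus
the coboundary. This holds for any family `θ`; normalization only matters for membership in `B³`. -/
theorem structureMaps_sub_structureMaps {T : Stick A} (θ : ∀ s, T.obj s ≅ S.obj s) :
    S.structureMaps - T.structureMaps = coboundary (T.mu θ, T.nu θ) := by
  ext <;> simp only [structureMaps, coboundary, Prod.fst_sub, Prod.snd_sub, Pi.sub_apply,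
    T.xi_eq_value θ, T.eta_eq_value θ, T.alpha_eq_value θ, T.lam_eq_value θ, T.rho_eq_value θ,
    T.beta_eq_value θ, value_sumAssoc, value_sumComm, value_prodAssoc, value_prodSum, value_sumProd,
    value_prodBraid] <;> module

end Stick

end BrAnn
namespace BrAnn

/-! ## The cocycle conditions -/

section TensorHomForm

variable {C : Type u} [Category.{v} C] [MonoidalCategory C]

/-- The coherence axioms are put in a form with tensor products of morphisms instead of whiskerings,
with inverse associators where the orientation of `a` and `a⁺` requires them. They then translate
directly into `sumMap` and `prodMap`. -/
theorem pentagon_inv_tensorHom (W X Y Z : C) :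
    (𝟙 W ⊗ₘ (α_ X Y Z).inv) ≫ (α_ W (X ⊗ Y) Z).inv ≫ ((α_ W X Y).inv ⊗ₘ 𝟙 Z) =
      (α_ W X (Y ⊗ Z)).inv ≫ (α_ (W ⊗ X) Y Z).inv := by
  simp

theorem triangle_inv_tensorHom (X Y : C) :
    (α_ X (𝟙_ C) Y).inv ≫ ((ρ_ X).hom ⊗ₘ 𝟙 Y) = 𝟙 X ⊗ₘ (λ_ Y).hom := by
  simp

theorem hexagon_reverse_tensorHom [BraidedCategory C] (X Y Z : C) :
    (α_ X Y Z).inv ≫ (β_ (X ⊗ Y) Z).hom ≫ (α_ Z X Y).inv =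
      (𝟙 X ⊗ₘ (β_ Y Z).hom) ≫ (α_ X Z Y).inv ≫ ((β_ X Z).hom ⊗ₘ 𝟙 Y) := by
  rw [id_tensorHom, tensorHom_id]
  exact BraidedCategory.hexagon_reverse X Y Z

theorem hexagon_forward_tensorHom [BraidedCategory C] (X Y Z : C) :
    (α_ X Y Z).hom ≫ (β_ X (Y ⊗ Z)).hom ≫ (α_ Y Z X).hom =
      ((β_ X Y).hom ⊗ₘ 𝟙 Z) ≫ (α_ Y X Z).hom ≫ (𝟙 Y ⊗ₘ (β_ X Z).hom) := by
  rw [id_tensorHom, tensorHom_id]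
  exact BraidedCategory.hexagon_forward X Y Z

theorem tensorμ_eq_tensorHom [BraidedCategory C] (X₁ X₂ Y₁ Y₂ : C) :
    tensorμ X₁ X₂ Y₁ Y₂ = (α_ X₁ X₂ (Y₁ ⊗ Y₂)).hom ≫ (𝟙 X₁ ⊗ₘ (α_ X₂ Y₁ Y₂).inv) ≫
      (𝟙 X₁ ⊗ₘ ((β_ X₂ Y₁).hom ⊗ₘ 𝟙 Y₂)) ≫ (𝟙 X₁ ⊗ₘ (α_ Y₁ X₂ Y₂).hom) ≫
        (α_ X₁ Y₁ (X₂ ⊗ Y₂)).inv := by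
  simp only [id_tensorHom, tensorHom_id]
  rfl

end TensorHomForm

namespace Stick

open Marked AnnCategory BraidedAnnCategory

variable {A : Type u} [Category.{v} A] [MonoidalCategory A] [BraidedCategory A]
  [SymCatGroup A] [BraidedAnnCategory A] (S : Stick A)

/-- A representative, marked by the identity. -/
noncomputable abbrev rep (s : Pi0 A) : Marked S := S.marked S.selfMark s

/-- The pentagon is read between marked representatives and values are taken. A vertex such as `X_x
⊕ X_y` has class `x + y`, which produces `ξ(x + y, z, t)` without replacing it by a representative.
The following identities arise from the other coherence diagrams in the same way. -/
theorem xi_pentagon (x y z t : Pi0 A) : S.xi y z t - S.xi (x + y) z t + S.xi x (y + z) t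
    - S.xi x y (z + t) + S.xi x y z = 0 := by
  have h : sumMap (𝟙 (S.rep x)) (sumAssoc (S.rep y) (S.rep z) (S.rep t)).hom ≫
      (sumAssoc (S.rep x) ((S.rep y).sum (S.rep z)) (S.rep t)).hom ≫
      sumMap (sumAssoc (S.rep x) (S.rep y) (S.rep z)).hom (𝟙 (S.rep t)) =
      (sumAssoc (S.rep x) (S.rep y) ((S.rep z).sum (S.rep t))).hom ≫
      (sumAssoc ((S.rep x).sum (S.rep y)) (S.rep z) (S.rep t)).hom :=
    @pentagon_inv_tensorHom A _ SymCatGroup.plus _ _ _ _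
  have h := congrArg value h
  simp only [value_comp, value_sumMap, value_id, value_sumAssoc] at h
  linear_combination (norm := module) h

theorem xi_eta_hexagon (x y z : Pi0 A) : S.xi x y z - S.xi x z y + S.xi z x y + S.eta (x + y) z
    - S.eta x z - S.eta y z = 0 := by
  have h : (sumAssoc (S.rep x) (S.rep y) (S.rep z)).hom ≫
      (sumComm ((S.rep x).sum (S.rep y)) (S.rep z)).hom ≫
      (sumAssoc (S.rep z) (S.rep x) (S.rep y)).hom =
      sumMap (𝟙 (S.rep x)) (sumComm (S.rep y) (S.rep z)).hom ≫
      (sumAssoc (S.rep x) (S.rep z) (S.rep y)).hom ≫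
      sumMap (sumComm (S.rep x) (S.rep z)).hom (𝟙 (S.rep y)) :=
    @hexagon_reverse_tensorHom A _ SymCatGroup.plus SymCatGroup.plusSymm.toBraidedCategory _ _ _
  have h := congrArg value h
  simp only [value_comp, value_sumMap, value_id, value_sumAssoc, value_sumComm] at h
  linear_combination (norm := module) h

theorem eta_symmetry (x y : Pi0 A) : S.eta x y + S.eta y x = 0 := by
  have h : (sumComm (S.rep x) (S.rep y)).hom ≫ (sumComm (S.rep y) (S.rep x)).hom = 𝟙 _ :=
    @SymmetricCategory.symmetry A _ SymCatGroup.plus SymCatGroup.plusSymm _ _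
  simpa only [value_comp, value_id, value_sumComm] using congrArg value h

theorem lam_eta (x y z : Pi0 A) :
    x • S.eta y z - S.eta (x * y) (x * z) = S.lam x y z - S.lam x z y := by
  have h : prodMap (𝟙 (S.rep x)) (sumComm (S.rep y) (S.rep z)).hom ≫
      (prodSum (S.rep x) (S.rep z) (S.rep y)).hom =
      (prodSum (S.rep x) (S.rep y) (S.rep z)).hom ≫
      (sumComm ((S.rep x).prod (S.rep y)) ((S.rep x).prod (S.rep z))).hom := by
    have h := distL_comm (S.obj x) (S.obj y) (S.obj z)
    rw [← id_tensorHom] at h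
    exact h
  have h := congrArg value h
  simp only [value_comp, value_prodMap, value_id, value_sumComm, value_prodSum] at h
  linear_combination (norm := module) h

theorem rho_eta (x y z : Pi0 A) :
    z • S.eta x y - S.eta (x * z) (y * z) = S.rho x y z - S.rho y x z := by
  have h : prodMap (sumComm (S.rep x) (S.rep y)).hom (𝟙 (S.rep z)) ≫
      (sumProd (S.rep y) (S.rep x) (S.rep z)).hom =
      (sumProd (S.rep x) (S.rep y) (S.rep z)).hom ≫
      (sumComm ((S.rep x).prod (S.rep z)) ((S.rep y).prod (S.rep z))).hom := by
    have h := distR_comm (S.obj x) (S.obj y) (S.obj z)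
    rw [← tensorHom_id] at h
    exact h
  have h := congrArg value h
  simp only [value_comp, value_prodMap, value_id, value_sumComm, value_sumProd] at h
  linear_combination (norm := module) h

theorem lam_xi (x y z t : Pi0 A) : x • S.xi y z t - S.xi (x * y) (x * z) (x * t) =
    S.lam x z t - S.lam x (y + z) t + S.lam x y (z + t) - S.lam x y z := by
  have h : prodMap (𝟙 (S.rep x)) (sumAssoc (S.rep y) (S.rep z) (S.rep t)).hom ≫
      (prodSum (S.rep x) ((S.rep y).sum (S.rep z)) (S.rep t)).hom ≫
      sumMap (prodSum (S.rep x) (S.rep y) (S.rep z)).hom (𝟙 ((S.rep x).prod (S.rep t))) =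
      (prodSum (S.rep x) (S.rep y) ((S.rep z).sum (S.rep t))).hom ≫
      sumMap (𝟙 ((S.rep x).prod (S.rep y))) (prodSum (S.rep x) (S.rep z) (S.rep t)).hom ≫
      (sumAssoc ((S.rep x).prod (S.rep y)) ((S.rep x).prod (S.rep z))
        ((S.rep x).prod (S.rep t))).hom := by
    have h := distL_assoc (S.obj x) (S.obj y) (S.obj z) (S.obj t)
    rw [← id_tensorHom] at h
    exact h
  have h := congrArg value h
  simp only [value_comp, value_prodMap, value_sumMap, value_id, value_sumAssoc,
    value_prodSum] at h
  linear_combination (norm := module) h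

theorem rho_xi (x y z t : Pi0 A) : t • S.xi x y z - S.xi (x * t) (y * t) (z * t) =
    S.rho y z t - S.rho (x + y) z t + S.rho x (y + z) t - S.rho x y t := by
  have h : prodMap (sumAssoc (S.rep x) (S.rep y) (S.rep z)).hom (𝟙 (S.rep t)) ≫
      (sumProd ((S.rep x).sum (S.rep y)) (S.rep z) (S.rep t)).hom ≫
      sumMap (sumProd (S.rep x) (S.rep y) (S.rep t)).hom (𝟙 ((S.rep z).prod (S.rep t))) =
      (sumProd (S.rep x) ((S.rep y).sum (S.rep z)) (S.rep t)).hom ≫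
      sumMap (𝟙 ((S.rep x).prod (S.rep t))) (sumProd (S.rep y) (S.rep z) (S.rep t)).hom ≫
      (sumAssoc ((S.rep x).prod (S.rep t)) ((S.rep y).prod (S.rep t))
        ((S.rep z).prod (S.rep t))).hom := by
    have h := distR_assoc (S.obj x) (S.obj y) (S.obj z) (S.obj t)
    rw [← tensorHom_id] at h
    exact h
  have h := congrArg value h
  simp only [value_comp, value_prodMap, value_sumMap, value_id, value_sumAssoc,
    value_sumProd] at h
  linear_combination (norm := module) h

/-- The canonical morphism `(P + Q) + (T + U) ⟶ (P + T) + (Q + U)` of marked objects. -/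
noncomputable def sumSwap {S : Stick A} (P Q T U : Marked S) :
    (P.sum Q).sum (T.sum U) ⟶ (P.sum T).sum (Q.sum U) :=
  homMk (addSwap P.pt Q.pt T.pt U.pt)

theorem sumSwap_eq {S : Stick A} (P Q T U : Marked S) :
    sumSwap P Q T U = (sumAssoc P Q (T.sum U)).inv ≫ sumMap (𝟙 P) (sumAssoc Q T U).hom ≫
      sumMap (𝟙 P) (sumMap (sumComm Q T).hom (𝟙 U)) ≫ sumMap (𝟙 P) (sumAssoc T Q U).inv ≫
        (sumAssoc P T (Q.sum U)).hom :=
  @tensorμ_eq_tensorHom A _ SymCatGroup.plus SymCatGroup.plusSymm.toBraidedCategory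
    P.pt Q.pt T.pt U.pt

theorem lam_rho_swap (x y z t : Pi0 A) :
    S.rho x y (z + t) - S.rho x y z - S.rho x y t + S.lam x z t + S.lam y z t
      - S.lam (x + y) z t =
    - S.xi (x * z + x * t) (y * z) (y * t) + S.xi (x * z) (x * t) (y * z)
      - S.eta (x * t) (y * z) + S.xi (x * z + y * z) (x * t) (y * t)
      - S.xi (x * z) (y * z) (x * t) := by
  have h : (prodSum ((S.rep x).sum (S.rep y)) (S.rep z) (S.rep t)).hom ≫
      sumMap (sumProd (S.rep x) (S.rep y) (S.rep z)).hom
        (sumProd (S.rep x) (S.rep y) (S.rep t)).hom ≫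
      sumSwap ((S.rep x).prod (S.rep z)) ((S.rep y).prod (S.rep z))
        ((S.rep x).prod (S.rep t)) ((S.rep y).prod (S.rep t)) =
      (sumProd (S.rep x) (S.rep y) ((S.rep z).sum (S.rep t))).hom ≫
      sumMap (prodSum (S.rep x) (S.rep z) (S.rep t)).hom
        (prodSum (S.rep y) (S.rep z) (S.rep t)).hom :=
    dist_swap (S.obj x) (S.obj y) (S.obj z) (S.obj t)
  have h := congrArg value h
  rw [sumSwap_eq] at h
  simp only [value_comp, value_inv, value_sumMap, value_id, value_sumAssoc, value_sumComm,
    value_sumProd, value_prodSum] at h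
  -- The swap contributes values of `ξ` with a sum in an outer argument. Subtracting the pentagons
  -- before and after exchanging the two middle summands trades them for the terms of the statement,
  -- and antisymmetry reverses the arguments of `η`.
  have h1 := S.xi_pentagon (x * z) (y * z) (x * t) (y * t)
  have h2 := S.xi_pentagon (x * z) (x * t) (y * z) (y * t)
  have h3 := S.eta_symmetry (x * t) (y * z)
  -- The terms with the sum of the middle summands as second argument then coincide and cancel.
  rw [add_comm (y * z) (x * t)] at h1
  linear_combination (norm := module) h1 - h2 + h3 - h

theorem alpha_lam (x y z t : Pi0 A) :
    S.alpha x y (z + t) - S.alpha x y z - S.alpha x y t =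
      x • S.lam y z t + S.lam x (y * z) (y * t) - S.lam (x * y) z t := by
  have h : (prodAssoc (S.rep x) (S.rep y) ((S.rep z).sum (S.rep t))).hom ≫
      (prodSum ((S.rep x).prod (S.rep y)) (S.rep z) (S.rep t)).hom =
      prodMap (𝟙 (S.rep x)) (prodSum (S.rep y) (S.rep z) (S.rep t)).hom ≫
      (prodSum (S.rep x) ((S.rep y).prod (S.rep z)) ((S.rep y).prod (S.rep t))).hom ≫
      sumMap (prodAssoc (S.rep x) (S.rep y) (S.rep z)).hom
        (prodAssoc (S.rep x) (S.rep y) (S.rep t)).hom := by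
    have h := distL_mul (S.obj x) (S.obj y) (S.obj z) (S.obj t)
    rw [← id_tensorHom] at h
    exact h
  have h := congrArg value h
  simp only [value_comp, value_prodMap, value_sumMap, value_id, value_prodAssoc,
    value_prodSum] at h
  linear_combination (norm := module) h

theorem alpha_lam_rho (x y z t : Pi0 A) :
    S.alpha x (y + z) t - S.alpha x y t - S.alpha x z t =
      x • S.rho y z t - S.rho (x * y) (x * z) t + S.lam x (y * t) (z * t) - t • S.lam x y z := by
  have h : (prodAssoc (S.rep x) ((S.rep y).sum (S.rep z)) (S.rep t)).hom ≫
      prodMap (prodSum (S.rep x) (S.rep y) (S.rep z)).hom (𝟙 (S.rep t)) ≫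
      (sumProd ((S.rep x).prod (S.rep y)) ((S.rep x).prod (S.rep z)) (S.rep t)).hom =
      prodMap (𝟙 (S.rep x)) (sumProd (S.rep y) (S.rep z) (S.rep t)).hom ≫
      (prodSum (S.rep x) ((S.rep y).prod (S.rep t)) ((S.rep z).prod (S.rep t))).hom ≫
      sumMap (prodAssoc (S.rep x) (S.rep y) (S.rep t)).hom
        (prodAssoc (S.rep x) (S.rep z) (S.rep t)).hom := by
    have h := distL_distR (S.obj x) (S.obj y) (S.obj z) (S.obj t)
    rw [← id_tensorHom, ← tensorHom_id] at h
    exact h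
  have h := congrArg value h
  simp only [value_comp, value_prodMap, value_sumMap, value_id, value_prodAssoc,
    value_prodSum, value_sumProd] at h
  linear_combination (norm := module) h

theorem alpha_rho (x y z t : Pi0 A) :
    S.alpha (x + y) z t - S.alpha x z t - S.alpha y z t =
      - (t • S.rho x y z) - S.rho (x * z) (y * z) t + S.rho x y (z * t) := by
  have h : (sumProd (S.rep x) (S.rep y) ((S.rep z).prod (S.rep t))).hom ≫
      sumMap (prodAssoc (S.rep x) (S.rep z) (S.rep t)).hom
        (prodAssoc (S.rep y) (S.rep z) (S.rep t)).hom =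
      (prodAssoc ((S.rep x).sum (S.rep y)) (S.rep z) (S.rep t)).hom ≫
      prodMap (sumProd (S.rep x) (S.rep y) (S.rep z)).hom (𝟙 (S.rep t)) ≫
      (sumProd ((S.rep x).prod (S.rep z)) ((S.rep y).prod (S.rep z)) (S.rep t)).hom := by
    have h := distR_mul (S.obj x) (S.obj y) (S.obj z) (S.obj t)
    rw [← tensorHom_id] at h
    exact h
  have h := congrArg value h
  simp only [value_comp, value_prodMap, value_sumMap, value_id, value_prodAssoc,
    value_sumProd] at h
  linear_combination (norm := module) -h

theorem alpha_pentagon (x y z t : Pi0 A) : x • S.alpha y z t - S.alpha (x * y) z t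
    + S.alpha x (y * z) t - S.alpha x y (z * t) + t • S.alpha x y z = 0 := by
  have h : prodMap (𝟙 (S.rep x)) (prodAssoc (S.rep y) (S.rep z) (S.rep t)).hom ≫
      (prodAssoc (S.rep x) ((S.rep y).prod (S.rep z)) (S.rep t)).hom ≫
      prodMap (prodAssoc (S.rep x) (S.rep y) (S.rep z)).hom (𝟙 (S.rep t)) =
      (prodAssoc (S.rep x) (S.rep y) ((S.rep z).prod (S.rep t))).hom ≫
      (prodAssoc ((S.rep x).prod (S.rep y)) (S.rep z) (S.rep t)).hom :=
    pentagon_inv_tensorHom _ _ _ _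
  have h := congrArg value h
  simp only [value_comp, value_prodMap, value_id, value_prodAssoc] at h
  linear_combination (norm := module) h

theorem alpha_beta_reverse (x y z : Pi0 A) : S.alpha x y z - S.alpha x z y + S.alpha z x y
    - x • S.beta y z + S.beta (x * y) z - y • S.beta x z = 0 := by
  have h : (prodAssoc (S.rep x) (S.rep y) (S.rep z)).hom ≫
      (prodBraid ((S.rep x).prod (S.rep y)) (S.rep z)).hom ≫
      (prodAssoc (S.rep z) (S.rep x) (S.rep y)).hom =
      prodMap (𝟙 (S.rep x)) (prodBraid (S.rep y) (S.rep z)).hom ≫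
      (prodAssoc (S.rep x) (S.rep z) (S.rep y)).hom ≫
      prodMap (prodBraid (S.rep x) (S.rep z)).hom (𝟙 (S.rep y)) :=
    hexagon_reverse_tensorHom _ _ _
  have h := congrArg value h
  simp only [value_comp, value_prodMap, value_id, value_prodAssoc, value_prodBraid] at h
  linear_combination (norm := module) h

theorem alpha_beta_forward (x y z : Pi0 A) : S.alpha x y z - S.alpha y x z + S.alpha y z x
    + y • S.beta x z - S.beta x (y * z) + z • S.beta x y = 0 := by
  have h : (prodAssoc (S.rep x) (S.rep y) (S.rep z)).inv ≫
      (prodBraid (S.rep x) ((S.rep y).prod (S.rep z))).hom ≫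
      (prodAssoc (S.rep y) (S.rep z) (S.rep x)).inv =
      prodMap (prodBraid (S.rep x) (S.rep y)).hom (𝟙 (S.rep z)) ≫
      (prodAssoc (S.rep y) (S.rep x) (S.rep z)).inv ≫
      prodMap (𝟙 (S.rep y)) (prodBraid (S.rep x) (S.rep z)).hom :=
    hexagon_forward_tensorHom _ _ _
  have h := congrArg value h
  simp only [value_comp, value_inv, value_prodMap, value_id, value_prodAssoc,
    value_prodBraid] at h
  linear_combination (norm := module) -h

theorem beta_lam_rho (x y z : Pi0 A) :
    S.beta x y - S.beta x (y + z) + S.beta x z = S.rho y z x - S.lam x y z := by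
  have h : (prodSum (S.rep x) (S.rep y) (S.rep z)).hom ≫
      sumMap (prodBraid (S.rep x) (S.rep y)).hom (prodBraid (S.rep x) (S.rep z)).hom =
      (prodBraid (S.rep x) ((S.rep y).sum (S.rep z))).hom ≫
      (sumProd (S.rep y) (S.rep z) (S.rep x)).hom :=
    braiding_dist (S.obj x) (S.obj y) (S.obj z)
  have h := congrArg value h
  simp only [value_comp, value_sumMap, value_prodSum, value_sumProd, value_prodBraid] at h
  linear_combination (norm := module) h

/-! ### Vanishing of the structure maps at zero and one -/

theorem xi_zero_middle (x z : Pi0 A) : S.xi x 0 z = 0 := by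
  have h : (sumAssoc (S.rep x) (zeroObj S) (S.rep z)).hom ≫
      sumMap (sumRightUnitor (S.rep x)).hom (𝟙 (S.rep z)) =
      sumMap (𝟙 (S.rep x)) (sumLeftUnitor (S.rep z)).hom :=
    @triangle_inv_tensorHom A _ SymCatGroup.plus _ _
  have h := congrArg value h
  simpa only [value_comp, value_sumMap, value_id, value_sumAssoc, value_sumLeftUnitor,
    value_sumRightUnitor, add_zero] using h

/-- The triangle axiom handles a middle zero. In the pentagon with two initial zeros, the terms with
a middle zero drop out and the other three leave one copy of `ξ(0, y, z)`. -/
theorem xi_zero_left (y z : Pi0 A) : S.xi 0 y z = 0 := by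
  have h := S.xi_pentagon 0 0 y z
  simp only [xi_zero_middle, zero_add] at h
  linear_combination (norm := module) h

theorem xi_zero_right (y z : Pi0 A) : S.xi y z 0 = 0 := by
  have h := S.xi_pentagon y z 0 0
  simp only [xi_zero_middle, zero_add, add_zero] at h
  linear_combination (norm := module) h

theorem alpha_one_middle (x z : Pi0 A) : S.alpha x 1 z = 0 := by
  have h : (prodAssoc (S.rep x) (oneObj S) (S.rep z)).hom ≫
      prodMap (prodRightUnitor (S.rep x)).hom (𝟙 (S.rep z)) =
      prodMap (𝟙 (S.rep x)) (prodLeftUnitor (S.rep z)).hom :=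
    triangle_inv_tensorHom _ _
  have h := congrArg value h
  simpa only [value_comp, value_prodMap, value_id, value_prodAssoc, value_prodLeftUnitor,
    value_prodRightUnitor, add_zero, smul_zero] using h

theorem alpha_one_left (y z : Pi0 A) : S.alpha 1 y z = 0 := by
  have h := S.alpha_pentagon 1 1 y z
  simp only [alpha_one_middle, one_mul, one_smul, smul_zero] at h
  linear_combination (norm := module) h

theorem alpha_one_right (y z : Pi0 A) : S.alpha y z 1 = 0 := by
  have h := S.alpha_pentagon y z 1 1
  simp only [alpha_one_middle, one_mul, mul_one, one_smul, smul_zero] at h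
  linear_combination (norm := module) h

theorem lam_one (y z : Pi0 A) : S.lam 1 y z = 0 := by
  have h : (prodSum (oneObj S) (S.rep y) (S.rep z)).hom ≫
      sumMap (prodLeftUnitor (S.rep y)).hom (prodLeftUnitor (S.rep z)).hom =
      (prodLeftUnitor ((S.rep y).sum (S.rep z))).hom := distL_one (S.obj y) (S.obj z)
  have h := congrArg value h
  simpa only [value_comp, value_sumMap, value_prodSum, value_prodLeftUnitor, add_zero] using h

theorem rho_one (y z : Pi0 A) : S.rho y z 1 = 0 := by
  have h : (sumProd (S.rep y) (S.rep z) (oneObj S)).hom ≫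
      sumMap (prodRightUnitor (S.rep y)).hom (prodRightUnitor (S.rep z)).hom =
      (prodRightUnitor ((S.rep y).sum (S.rep z))).hom := distR_one (S.obj y) (S.obj z)
  have h := congrArg value h
  simpa only [value_comp, value_sumMap, value_sumProd, value_prodRightUnitor, add_zero] using h

/-- Antisymmetry alone would only give `2η(0,0) = 0`; the hexagon at zero gives the vanishing
itself. -/
theorem eta_zero_zero : S.eta 0 0 = 0 := by
  have h := S.xi_eta_hexagon 0 0 0
  simp only [xi_zero_left, add_zero] at h
  linear_combination (norm := module) -h

/-- With two zeros in the identity relating `λ` and `ξ`, all values of `ξ` vanish and `λ(x,0,z)` is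
reduced to `λ(x,0,0)`. -/
theorem lam_zero_middle (x z : Pi0 A) : S.lam x 0 z = 0 := by
  have h := S.lam_xi x 0 0 z
  simp only [mul_zero, xi_zero_left, zero_add, smul_zero, lam_zero_zero] at h
  linear_combination (norm := module) -h

theorem lam_zero_right (x z : Pi0 A) : S.lam x z 0 = 0 := by
  have h := S.lam_xi x z 0 0
  simp only [mul_zero, xi_zero_right, add_zero, smul_zero, lam_zero_zero] at h
  linear_combination (norm := module) h

theorem rho_zero_left (x z : Pi0 A) : S.rho 0 x z = 0 := by
  have h := S.rho_xi 0 0 x z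
  simp only [zero_mul, xi_zero_left, zero_add, smul_zero, rho_zero_zero] at h
  linear_combination (norm := module) -h

theorem rho_zero_middle (x z : Pi0 A) : S.rho x 0 z = 0 := by
  have h := S.rho_xi x 0 0 z
  simp only [zero_mul, xi_zero_right, add_zero, smul_zero, rho_zero_zero] at h
  linear_combination (norm := module) h

/-- In the swap identity with `x = y = 0`, the right side vanishes, using `η(0,0) = 0`, and so do
the values `ρ(0,0,·)`. Three copies of `λ(0,·,·)` with signs `+`, `+`, `-` remain. -/
theorem lam_zero_left (y z : Pi0 A) : S.lam 0 y z = 0 := by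
  have h := S.lam_rho_swap 0 0 y z
  simp only [zero_mul, xi_zero_left, eta_zero_zero, add_zero, rho_zero_zero] at h
  linear_combination (norm := module) h

theorem rho_zero_right (y z : Pi0 A) : S.rho y z 0 = 0 := by
  have h := S.lam_rho_swap y z 0 0
  simp only [mul_zero, xi_zero_left, eta_zero_zero, add_zero, lam_zero_zero] at h
  linear_combination (norm := module) -h

/-- The defect of additivity of `α` in an argument is expressed by `λ` and `ρ`; at `0 + 0` it is
`-α` on one side, while the other vanishes. The same works in each argument. -/
theorem alpha_zero_left (y z : Pi0 A) : S.alpha 0 y z = 0 := by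
  have h := S.alpha_rho 0 0 y z
  simp only [zero_mul, rho_zero_zero, add_zero, smul_zero] at h
  linear_combination (norm := module) -h

theorem alpha_zero_middle (y z : Pi0 A) : S.alpha y 0 z = 0 := by
  have h := S.alpha_lam_rho y 0 0 z
  simp only [zero_mul, mul_zero, rho_zero_zero, lam_zero_zero, add_zero, smul_zero] at h
  linear_combination (norm := module) -h

theorem alpha_zero_right (y z : Pi0 A) : S.alpha y z 0 = 0 := by
  have h := S.alpha_lam y z 0 0
  simp only [mul_zero, lam_zero_zero, add_zero, smul_zero] at h
  linear_combination (norm := module) -h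

theorem structureMaps_mem_Z3ab : S.structureMaps ∈ Z3ab (Pi0 A) (Pi1 A) :=
  show IsAbCocycle S.structureMaps from
  { macLane :=
      { s1 := S.xi_pentagon
        s2 := S.xi_eta_hexagon
        s3 := S.eta_symmetry
        s4 := S.lam_eta
        s5 := S.rho_eta
        s6 := S.lam_xi
        s7 := S.rho_xi
        s8 := S.lam_rho_swap
        s9 := S.alpha_lam
        s10 := S.alpha_lam_rho
        s11 := S.alpha_rho
        s12 := S.alpha_pentagon
        xi_norm := fun y z => ⟨S.xi_zero_left y z, S.xi_zero_middle y z, S.xi_zero_right y z⟩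
        alpha_norm_one := fun y z =>
          ⟨S.alpha_one_left y z, S.alpha_one_middle y z, S.alpha_one_right y z⟩
        alpha_norm_zero := fun y z =>
          ⟨S.alpha_zero_left y z, S.alpha_zero_middle y z, S.alpha_zero_right y z⟩
        lam_norm := fun y z => ⟨S.lam_one y z, S.lam_zero_left y z, S.lam_zero_middle y z,
          S.lam_zero_right y z⟩
        rho_norm := fun y z => ⟨S.rho_one y z, S.rho_zero_left y z, S.rho_zero_middle y z,
          S.rho_zero_right y z⟩ }
    s20 := S.alpha_beta_reverse
    s21 := S.alpha_beta_forward
    s22 := S.beta_lam_rho }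

end Stick

end BrAnn
namespace BrAnn

/-! ## The braided Ann-equivalence given by a coboundary -/

section CoboundaryFunctor

open MacLaneCochain

variable {R : Type u} {M : Type v} [CommRing R] [AddCommGroup M] [Module R M] {z z' : Z3ab R M}
  {g : (R → R → M) × (R → R → M)} (hg : IsNormalized g) (h : z'.1 - z.1 = coboundary g)

include h in
theorem sub_eq_of_coboundary :
    (∀ a b c, xi z'.1.1 a b c - xi z.1.1 a b c =
      g.1 b c - g.1 (a + b) c + g.1 a (b + c) - g.1 a b) ∧
    (∀ a b, eta z'.1.1 a b - eta z.1.1 a b = g.1 a b - g.1 b a) ∧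
    (∀ a b c, alpha z'.1.1 a b c - alpha z.1.1 a b c =
      a • g.2 b c - g.2 (a * b) c + g.2 a (b * c) - c • g.2 a b) ∧
    (∀ a b c, lam z'.1.1 a b c - lam z.1.1 a b c =
      g.2 a (b + c) - g.2 a b - g.2 a c + a • g.1 b c - g.1 (a * b) (a * c)) ∧
    (∀ a b c, rho z'.1.1 a b c - rho z.1.1 a b c =
      g.2 (a + b) c - g.2 a c - g.2 b c + c • g.1 a b - g.1 (a * c) (b * c)) ∧
    ∀ a b, z'.1.2 a b - z.1.2 a b = g.2 a b - g.2 b a :=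
  ⟨fun a b c => congrArg (fun k : AbCochain R M => xi k.1 a b c) h,
    fun a b => congrArg (fun k : AbCochain R M => eta k.1 a b) h,
    fun a b c => congrArg (fun k : AbCochain R M => alpha k.1 a b c) h,
    fun a b c => congrArg (fun k : AbCochain R M => lam k.1 a b c) h,
    fun a b c => congrArg (fun k : AbCochain R M => rho k.1 a b c) h,
    fun a b => congrArg (fun k : AbCochain R M => k.2 a b) h⟩

/-- The identity functor with the comparison `μ` for the sums. -/
def coboundaryPlusCore : @Functor.CoreMonoidal (TypeRM z) _ SymCatGroup.plus (TypeRM z') _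
    SymCatGroup.plus (idFunctor z z') :=
  @Functor.CoreMonoidal.mk (TypeRM z) _ SymCatGroup.plus (TypeRM z') _
    SymCatGroup.plus (idFunctor z z')
    (rmIso rfl 0)
    (fun x y => rmIso rfl (g.1 x.el y.el))
    (fun {x y} f w => hom_ext (by
      change val f + g.1 y.el w.el = g.1 x.el w.el + val f
      rw [el_eq f, add_comm]))
    (fun {x y} w f => hom_ext (by
      change val f + g.1 w.el y.el = g.1 w.el x.el + val f
      rw [el_eq f, add_comm]))
    (fun x y w => hom_ext (by
      change g.1 x.el y.el + (g.1 (x.el + y.el) w.el + - xi z.1.1 x.el y.el w.el) =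
        - xi z'.1.1 x.el y.el w.el + (g.1 y.el w.el + g.1 x.el (y.el + w.el))
      linear_combination (norm := module) (sub_eq_of_coboundary h).1 x.el y.el w.el))
    (fun x => hom_ext (by
      change (0 : M) = 0 + (g.1 0 x.el + 0)
      rw [(hg.mu_norm x.el).1, zero_add, zero_add]))
    (fun x => hom_ext (by
      change (0 : M) = 0 + (g.1 x.el 0 + 0)
      rw [(hg.mu_norm x.el).2, zero_add, zero_add]))

/-- The identity functor with the comparison `ν` for the products. -/
def coboundaryProdCore : (idFunctor z z').CoreMonoidal where
  εIso := rmIso rfl 0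
  μIso x y := rmIso rfl (g.2 x.el y.el)
  μIso_hom_natural_left {x y} f w := hom_ext (by
    change w.el • val f + g.2 y.el w.el = g.2 x.el w.el + w.el • val f
    rw [el_eq f, add_comm])
  μIso_hom_natural_right {x y} w f := hom_ext (by
    change w.el • val f + g.2 w.el y.el = g.2 w.el x.el + w.el • val f
    rw [el_eq f, add_comm])
  associativity x y w := hom_ext (by
    change w.el • g.2 x.el y.el + (g.2 (x.el * y.el) w.el + - alpha z.1.1 x.el y.el w.el) =
      - alpha z'.1.1 x.el y.el w.el + (x.el • g.2 y.el w.el + g.2 x.el (y.el * w.el))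
    linear_combination (norm := module) (sub_eq_of_coboundary h).2.2.1 x.el y.el w.el)
  left_unitality x := hom_ext (by
    change (0 : M) = x.el • 0 + (g.2 1 x.el + 0)
    rw [(hg.nu_norm x.el).2.2.1, smul_zero, zero_add, zero_add])
  right_unitality x := hom_ext (by
    change (0 : M) = x.el • 0 + (g.2 x.el 1 + 0)
    rw [(hg.nu_norm x.el).2.2.2, smul_zero, zero_add, zero_add])

/-- The braided Ann-functor on the identity functor with comparisons `μ` and `ν`. -/
def coboundaryFunctor : BrAnnFunctor (TypeRM z) (TypeRM z') where
  functor := idFunctor z z'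
  plusBraided :=
    @Functor.Braided.mk (TypeRM z) _ SymCatGroup.plus SymCatGroup.plusSymm.toBraidedCategory
      (TypeRM z') _ SymCatGroup.plus SymCatGroup.plusSymm.toBraidedCategory (idFunctor z z')
      (@Functor.CoreMonoidal.toMonoidal (TypeRM z) _ SymCatGroup.plus (TypeRM z') _
        SymCatGroup.plus (idFunctor z z') (coboundaryPlusCore hg h))
      (fun x y => hom_ext (by
        change g.1 x.el y.el + eta z.1.1 x.el y.el = eta z'.1.1 x.el y.el + g.1 y.el x.el
        linear_combination (norm := module) -(sub_eq_of_coboundary h).2.1 x.el y.el))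
  prodBraided :=
    { (coboundaryProdCore hg h).toMonoidal with
      braided := fun x y => hom_ext (by
        change g.2 x.el y.el + z.1.2 x.el y.el = z'.1.2 x.el y.el + g.2 y.el x.el
        linear_combination (norm := module) -(sub_eq_of_coboundary h).2.2.2.2.2 x.el y.el) }
  map_distL x y w := hom_ext (by
    change (x.el • g.1 y.el w.el + (y.el + w.el) • (0 : M)) +
        (g.2 x.el (y.el + w.el) + lam z.1.1 x.el y.el w.el) =
      lam z'.1.1 x.el y.el w.el + ((g.2 x.el y.el + g.2 x.el w.el) +
        g.1 (x.el * y.el) (x.el * w.el))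
    linear_combination (norm := module) -(sub_eq_of_coboundary h).2.2.2.1 x.el y.el w.el)
  map_distR x y w := hom_ext (by
    change ((x.el + y.el) • (0 : M) + w.el • g.1 x.el y.el) +
        (g.2 (x.el + y.el) w.el + rho z.1.1 x.el y.el w.el) =
      rho z'.1.1 x.el y.el w.el + ((g.2 x.el w.el + g.2 y.el w.el) +
        g.1 (x.el * w.el) (y.el * w.el))
    linear_combination (norm := module) -(sub_eq_of_coboundary h).2.2.2.2.1 x.el y.el w.el)

/-- The composite of the identity functors as a functor isomorphic to the identity. -/
def idFunctorCompIso (z z' : Z3ab R M) : idFunctor z z' ⋙ idFunctor z' z ≅ 𝟭 (TypeRM z) :=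
  NatIso.ofComponents (fun x => rmIso rfl 0) (fun f => hom_ext (by
    change val f + 0 = 0 + val f
    rw [add_comm]))

/-- The comparisons of the composite have components `g + g' = 0`, so the isomorphism with zero
components is monoidal for both operations. -/
theorem isHomotopyToId_idFunctorCompIso {g' : (R → R → M) × (R → R → M)}
    (hg' : IsNormalized g') (h' : z.1 - z'.1 = coboundary g') (hgg' : g + g' = 0) :
    BrAnnFunctor.IsHomotopyToId (coboundaryFunctor hg h) (coboundaryFunctor hg' h')
      (idFunctorCompIso z z') := by
  have h1 (x y : R) : g.1 x y + g'.1 x y = 0 := congrFun (congrFun (congrArg Prod.fst hgg') x) y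
  have h2 (x y : R) : g.2 x y + g'.2 x y = 0 := congrFun (congrFun (congrArg Prod.snd hgg') x) y
  constructor
  · refine @NatTrans.IsMonoidal.mk _ _ SymCatGroup.plus _ _ SymCatGroup.plus _ _ _
      (BrAnnFunctor.plusComp (coboundaryFunctor hg h)
        (coboundaryFunctor hg' h')).toMonoidal.toLaxMonoidal
      (BrAnnFunctor.plusId (TypeRM z)).toMonoidal.toLaxMonoidal ?_ ?_
    · refine hom_ext ?_
      change ((0 : M) + 0) + 0 = 0
      simp
    · intro x y
      refine hom_ext ?_
      change (g'.1 x.el y.el + g.1 x.el y.el) + (0 : M) = ((0 : M) + 0) + 0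
      linear_combination (norm := module) h1 x.el y.el
  · refine @NatTrans.IsMonoidal.mk _ _ _ _ _ _ _ _ _
      (BrAnnFunctor.prodComp (coboundaryFunctor hg h)
        (coboundaryFunctor hg' h')).toMonoidal.toLaxMonoidal
      (Functor.Braided.instId (C := TypeRM z)).toMonoidal.toLaxMonoidal ?_ ?_
    · refine hom_ext ?_
      change ((0 : M) + 0) + 0 = 0
      simp
    · intro x y
      refine hom_ext ?_
      change (g'.2 x.el y.el + g.2 x.el y.el) + (0 : M) =
        (x.el • (0 : M) + y.el • (0 : M)) + 0
      linear_combination (norm := module) h2 x.el y.el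

theorem isEquivalence_coboundaryFunctor : (coboundaryFunctor hg h).IsEquivalence := by
  have hz : IsNormalized (0 : (R → R → M) × (R → R → M)) :=
    ⟨fun _ => ⟨rfl, rfl⟩, fun _ => ⟨rfl, rfl, rfl, rfl⟩⟩
  -- The inverse functor has comparisons `-g`, written as a difference so that closure of normalized
  -- pairs under subtraction applies.
  have h' : z.1 - z'.1 = coboundary (0 - g) := by
    have h0 : coboundary (0 : (R → R → M) × (R → R → M)) = 0 := by
      have := coboundary_sub (0 : (R → R → M) × (R → R → M)) 0
      rwa [sub_self, sub_self] at this
    rw [coboundary_sub, h0, ← h]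
    abel
  exact ⟨coboundaryFunctor (hz.sub hg) h',
    ⟨idFunctorCompIso z z', isHomotopyToId_idFunctorCompIso hg h (hz.sub hg) h' (by abel)⟩,
    ⟨idFunctorCompIso z' z, isHomotopyToId_idFunctorCompIso (hz.sub hg) h' hg h (by abel)⟩⟩

end CoboundaryFunctor

end BrAnn

/-! ### Comparison of two sticks in one braided Ann-category -/

theorem mainTheorem5 {A : Type u} [Category.{v} A] [MonoidalCategory A] [BraidedCategory A]
    [BrAnn.SymCatGroup A] [BrAnn.BraidedAnnCategory A] (S S' : BrAnn.Stick A) :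
    ∃ (hS : S.structureMaps ∈ BrAnn.Z3ab (BrAnn.Pi0 A) (BrAnn.Pi1 A))
      (hS' : S'.structureMaps ∈ BrAnn.Z3ab (BrAnn.Pi0 A) (BrAnn.Pi1 A)),
      (∃ F : BrAnn.BrAnnFunctor (S'.Reduced hS') (S.Reduced hS),
        F.functor = BrAnn.idFunctor ⟨S'.structureMaps, hS'⟩ ⟨S.structureMaps, hS⟩ ∧
          F.IsEquivalence) ∧
      (QuotientAddGroup.mk ⟨S.structureMaps, hS⟩ : BrAnn.H3ab (BrAnn.Pi0 A) (BrAnn.Pi1 A)) =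
        QuotientAddGroup.mk ⟨S'.structureMaps, hS'⟩ := by
  obtain ⟨θ, hθ⟩ := BrAnn.Stick.exists_isNormalizedMark S S'
  have h := BrAnn.Stick.structureMaps_sub_structureMaps (S := S) θ
  refine ⟨S.structureMaps_mem_Z3ab, S'.structureMaps_mem_Z3ab,
    ⟨BrAnn.coboundaryFunctor hθ.isNormalized h, rfl,
      BrAnn.isEquivalence_coboundaryFunctor hθ.isNormalized h⟩, ?_⟩
  -- Equality of cosets is tested on `-a + b`; exchanging the sides makes this the structure of `S`
  -- minus that of `S'`, which is `∂(μ, ν)`.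
  rw [eq_comm, QuotientAddGroup.eq, AddSubgroup.mem_addSubgroupOf]
  refine ⟨_, hθ.isNormalized, ?_⟩
  rw [← h, sub_eq_neg_add]
  rfl
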